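/- Let $Q$ be a type II$_1$ factor with trace $\tau$, let $H$ be a countable icc group (every non-trivial conjugacy class is infinite), and let $\sigma$ be an action of $H$ on $Q$ by trace-preserving $*$-automorphisms. Let $\omega$ be a free ultrafilter on $\mathbb{N}$, let $Q^\omega=\ell^\infty(\mathbb{N},Q)/\{(a_n):\lim_{n\to\omega}\|a_n\|_2=0\}$ be the tracial ultraproduct, where $\|a\|_2=\tau(a^*a)^{1/2}$, and let $(Q^\omega)^\sigma$ be the subalgebra of elements fixed by all the automorphisms $(x_n)^\omega\mapsto(\sigma_h(x_n))^\omega$, $h\in H$. Assume that (i) $\sigma$ is ergodic, i.e. $Q^\sigma=\mathbb{C}$; (ii) $(Q^\omega)^\sigma$ is diffuse, i.e. it has no minimal projections. Put $M=Q\rtimes_\sigma H$ and let $N=L(H)\subset M$ be the von Neumann subalgebra generated by the canonical unitaries $\lambda(h)$, $h\in H$. Then $M$ and $N$ are type II$_1$ factors and $N$ is irreducible in $M$, i.e. $N'\cap M\subset N$. Moreover $N$ has property gamma relative to $M$: if $\mathbb{E}_N$ denotes the trace-preserving conditional expectation of $M$ onto $N$, there is a norm-bounded sequence $(x_n)$ in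 $M$ such that $\|x_n\|_2=1$ and $\mathbb{E}_N(x_n)=0$ for every $n$, and $\|yx_n-x_ny\|_2\to0$ for every $y\in N$. -/

import Mathlib

open Filter Topology
open scoped InnerProductSpace ENNReal

noncomputable section

namespace RelGamma

universe u v

/-! ### The tracial ultraproduct

The construction is written for a normed *-algebra `A` and a functional `τ` with the few properties
that it needs; below it is applied to a von Neumann algebra with a faithful normal trace. -/

section Ultra

variable {A : Type u} [NormedRing A] [StarRing A] [NormedStarGroup A] [NormedAlgebra ℂ A]
  [StarModule ℂ A]

/-- The norm `‖x‖₂ = τ(x* x)^{1/2}`. -/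
def twoNorm (τ : A →ₗ[ℂ] ℂ) (x : A) : ℝ :=
  Real.sqrt (τ (star x * x)).re

/-- The properties of a trace that make `{a | lim ‖a n‖₂ = 0}` a *-ideal. -/
structure IsBoundedTrace (τ : A →ₗ[ℂ] ℂ) : Prop where
  map_mul_comm : ∀ x y, τ (x * y) = τ (y * x)
  nonneg : ∀ x, 0 ≤ (τ (star x * x)).re
  mul_le : ∀ a x, (τ (star (a * x) * (a * x))).re ≤ ‖a‖ ^ 2 * (τ (star x * x)).re

variable {τ : A →ₗ[ℂ] ℂ} (hτ : IsBoundedTrace τ)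

theorem sq_add_le (hτ : IsBoundedTrace τ) (x y : A) : (τ (star (x + y) * (x + y))).re ≤
    2 * (τ (star x * x)).re + 2 * (τ (star y * y)).re := by
  have h := hτ.nonneg (x - y)
  have h2 : star (x + y) * (x + y) + star (x - y) * (x - y) =
      (star x * x + star x * x) + (star y * y + star y * y) := by
    rw [star_add, star_sub]
    noncomm_ring
  have h3 := congrArg (fun z => (τ z).re) h2
  simp only [map_add, Complex.add_re] at h3
  linarith

theorem sq_star (hτ : IsBoundedTrace τ) (x : A) :
    (τ (star (star x) * star x)).re = (τ (star x * x)).re := by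
  rw [star_star, hτ.map_mul_comm]

theorem sq_mul_le' (hτ : IsBoundedTrace τ) (a x : A) : (τ (star (x * a) * (x * a))).re ≤
    ‖a‖ ^ 2 * (τ (star x * x)).re := by
  rw [← sq_star hτ (x * a), ← sq_star hτ x, star_mul, ← norm_star a]
  exact hτ.mul_le (star a) (star x)

theorem tendsto_twoNorm_iff (hτ : IsBoundedTrace τ) {ι : Type*} {l : Filter ι} (x : ι → A) :
    Tendsto (fun n => twoNorm τ (x n)) l (𝓝 0) ↔
      Tendsto (fun n => (τ (star (x n) * x n)).re) l (𝓝 0) := by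
  constructor
  · intro h
    have := h.pow 2
    simpa [twoNorm, Real.sq_sqrt (hτ.nonneg _)] using this
  · intro h
    have := (Real.continuous_sqrt.tendsto 0).comp h
    simpa [twoNorm, Function.comp_def] using this

/-- The algebra `ℓ^∞(ℕ, A)` of norm-bounded sequences. -/
def boundedSeq (A : Type u) [NormedRing A] [StarRing A] [NormedStarGroup A] [NormedAlgebra ℂ A]
    [StarModule ℂ A] : StarSubalgebra ℂ (ℕ → A) where
  carrier := {x | ∃ C : ℝ, ∀ n, ‖x n‖ ≤ C}
  mul_mem' := by
    rintro a b ⟨C, hC⟩ ⟨D, hD⟩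
    exact ⟨C * D, fun n => (norm_mul_le _ _).trans
      (mul_le_mul (hC n) (hD n) (norm_nonneg _) ((norm_nonneg _).trans (hC n)))⟩
  add_mem' := by
    rintro a b ⟨C, hC⟩ ⟨D, hD⟩
    exact ⟨C + D, fun n => (norm_add_le _ _).trans (add_le_add (hC n) (hD n))⟩
  algebraMap_mem' c := ⟨‖algebraMap ℂ A c‖, fun n => le_rfl⟩
  star_mem' := by
    rintro a ⟨C, hC⟩
    exact ⟨C, fun n => by simpa using hC n⟩

/-- The ideal `I_ω` of bounded sequences `(a n)` with `lim_{n → ω} ‖a n‖₂ = 0`. -/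
def nullIdeal (ω : Ultrafilter ℕ) : TwoSidedIdeal (boundedSeq A) :=
  TwoSidedIdeal.mk'
    {a : boundedSeq A | Tendsto (fun n => twoNorm τ ((a : ℕ → A) n)) ω (𝓝 0)}
    (by simp [twoNorm])
    (by
      intro x y hx hy
      simp only [Set.mem_ofPred_eq, tendsto_twoNorm_iff hτ] at *
      refine squeeze_zero (fun n => hτ.nonneg _) (fun n => sq_add_le hτ _ _) ?_
      simpa using (hx.const_mul 2).add (hy.const_mul 2))
    (by
      intro x hx
      simpa [twoNorm] using hx)
    (by
      intro x y hy
      obtain ⟨C, hC⟩ := x.2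
      simp only [Set.mem_ofPred_eq, tendsto_twoNorm_iff hτ] at *
      refine squeeze_zero (fun n => hτ.nonneg _) (fun n => (hτ.mul_le _ _).trans
        (mul_le_mul_of_nonneg_right (pow_le_pow_left₀ (norm_nonneg _) (hC n) 2)
          (hτ.nonneg _))) ?_
      simpa using hy.const_mul (C ^ 2))
    (by
      intro x y hx
      obtain ⟨C, hC⟩ := y.2
      simp only [Set.mem_ofPred_eq, tendsto_twoNorm_iff hτ] at *
      refine squeeze_zero (fun n => hτ.nonneg _) (fun n => (sq_mul_le' hτ _ _).trans
        (mul_le_mul_of_nonneg_right (pow_le_pow_left₀ (norm_nonneg _) (hC n) 2)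
          (hτ.nonneg _))) ?_
      simpa using hx.const_mul (C ^ 2))

theorem mem_nullIdeal {ω : Ultrafilter ℕ} {a : boundedSeq A} : a ∈ nullIdeal hτ ω ↔
    Tendsto (fun n => twoNorm τ ((a : ℕ → A) n)) ω (𝓝 0) :=
  TwoSidedIdeal.mem_mk' ..

/-- The ultraproduct `A^ω = ℓ^∞(ℕ, A) / I_ω`. -/
def Ultraproduct (ω : Ultrafilter ℕ) : Type u := (nullIdeal hτ ω).ringCon.Quotient

instance (ω : Ultrafilter ℕ) : Ring (Ultraproduct hτ ω) :=
  inferInstanceAs (Ring (nullIdeal hτ ω).ringCon.Quotient)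

instance (ω : Ultrafilter ℕ) : Algebra ℂ (Ultraproduct hτ ω) :=
  inferInstanceAs (Algebra ℂ (nullIdeal hτ ω).ringCon.Quotient)

/-- The class `(x n)^ω` of a bounded sequence. -/
def ultraMk (ω : Ultrafilter ℕ) : boundedSeq A →ₐ[ℂ] Ultraproduct hτ ω where
  toRingHom := (nullIdeal hτ ω).ringCon.mk'
  commutes' _ := rfl

theorem ultraMk_mul {ω : Ultrafilter ℕ} (a b : boundedSeq A) :
    ultraMk hτ ω (a * b) = ultraMk hτ ω a * ultraMk hτ ω b := map_mul (ultraMk hτ ω) a b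

theorem ultraMk_surjective (ω : Ultrafilter ℕ) : Function.Surjective (ultraMk hτ ω) :=
  (nullIdeal hτ ω).ringCon.mk'_surjective

theorem ultraMk_eq_iff {ω : Ultrafilter ℕ} {a b : boundedSeq A} :
    ultraMk hτ ω a = ultraMk hτ ω b ↔ Tendsto (fun n => twoNorm τ
      ((a : ℕ → A) n - (b : ℕ → A) n)) ω (𝓝 0) := by
  have h1 : ultraMk hτ ω a = ultraMk hτ ω b ↔ (nullIdeal hτ ω).ringCon a b :=
    (nullIdeal hτ ω).ringCon.eq
  rw [h1, TwoSidedIdeal.rel_iff, mem_nullIdeal]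
  rfl

/-- The map on `A^ω` induced by an entrywise map `f` on bounded sequences. -/
def ultraLift (ω : Ultrafilter ℕ) (f : boundedSeq A → boundedSeq A)
    (hf : ∀ a b, ultraMk hτ ω a = ultraMk hτ ω b → ultraMk hτ ω (f a) = ultraMk hτ ω (f b)) :
    Ultraproduct hτ ω → Ultraproduct hτ ω :=
  Quotient.lift (fun a => ultraMk hτ ω (f a))
    fun a b h => hf a b (((nullIdeal hτ ω).ringCon.eq).2 h)

theorem ultraLift_mk {ω : Ultrafilter ℕ} {f : boundedSeq A → boundedSeq A}
    (hf : ∀ a b, ultraMk hτ ω a = ultraMk hτ ω b → ultraMk hτ ω (f a) = ultraMk hτ ω (f b))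
    (a : boundedSeq A) : ultraLift hτ ω f hf (ultraMk hτ ω a) = ultraMk hτ ω (f a) := rfl

theorem star_rel (ω : Ultrafilter ℕ) (a b : boundedSeq A)
    (h : ultraMk hτ ω a = ultraMk hτ ω b) : ultraMk hτ ω (star a) = ultraMk hτ ω (star b) := by
  rw [ultraMk_eq_iff, tendsto_twoNorm_iff hτ] at *
  refine h.congr fun n => ?_
  rw [← sq_star hτ, star_sub]
  rfl

instance (ω : Ultrafilter ℕ) : Star (Ultraproduct hτ ω) where
  star := ultraLift hτ ω star (star_rel hτ ω)

theorem star_ultraMk {ω : Ultrafilter ℕ} (a : boundedSeq A) :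
    star (ultraMk hτ ω a) = ultraMk hτ ω (star a) := rfl

theorem ultra_star_mul (ω : Ultrafilter ℕ) (x y : Ultraproduct hτ ω) :
    star (x * y) = star y * star x := by
  obtain ⟨x, rfl⟩ := ultraMk_surjective hτ ω x
  obtain ⟨y, rfl⟩ := ultraMk_surjective hτ ω y
  rw [← ultraMk_mul, star_ultraMk, star_ultraMk, star_ultraMk, star_mul, ultraMk_mul]

instance (ω : Ultrafilter ℕ) : StarRing (Ultraproduct hτ ω) where
  star_involutive := by
    intro x
    obtain ⟨x, rfl⟩ := ultraMk_surjective hτ ω x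
    rw [star_ultraMk, star_ultraMk, star_star]
  star_mul := ultra_star_mul hτ ω
  star_add := by
    intro x y
    obtain ⟨x, rfl⟩ := ultraMk_surjective hτ ω x
    obtain ⟨y, rfl⟩ := ultraMk_surjective hτ ω y
    rw [← map_add, star_ultraMk, star_ultraMk, star_ultraMk, star_add, map_add]

instance (ω : Ultrafilter ℕ) : StarModule ℂ (Ultraproduct hτ ω) where
  star_smul := by
    intro c x
    obtain ⟨x, rfl⟩ := ultraMk_surjective hτ ω x
    rw [← map_smul, star_ultraMk, star_ultraMk, star_smul, map_smul]

/-- Entrywise application of a *-automorphism to bounded sequences. -/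
def seqMap (θ : A ≃⋆ₐ[ℂ] A) (hn : ∀ x, ‖θ x‖ ≤ ‖x‖) (a : boundedSeq A) : boundedSeq A :=
  ⟨fun n => θ ((a : ℕ → A) n), by
    obtain ⟨C, hC⟩ := a.2
    exact ⟨C, fun n => (hn _).trans (hC n)⟩⟩

theorem seqMap_rel {θ : A ≃⋆ₐ[ℂ] A} (hn : ∀ x, ‖θ x‖ ≤ ‖x‖)
    (hθ : ∀ x, τ (θ x) = τ x) (ω : Ultrafilter ℕ) (a b : boundedSeq A)
    (h : ultraMk hτ ω a = ultraMk hτ ω b) :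
    ultraMk hτ ω (seqMap θ hn a) = ultraMk hτ ω (seqMap θ hn b) := by
  rw [ultraMk_eq_iff] at *
  refine h.congr fun n => ?_
  have : (seqMap θ hn a : ℕ → A) n - (seqMap θ hn b : ℕ → A) n =
      θ ((a : ℕ → A) n - (b : ℕ → A) n) :=
    (map_sub θ _ _).symm
  rw [this, twoNorm, twoNorm, ← map_star, ← map_mul, hθ]

theorem ultraLift_seqMap_mul {θ : A ≃⋆ₐ[ℂ] A} (hn : ∀ x, ‖θ x‖ ≤ ‖x‖)
    (hθ : ∀ x, τ (θ x) = τ x) (ω : Ultrafilter ℕ) (x y : Ultraproduct hτ ω) :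
    ultraLift hτ ω (seqMap θ hn) (seqMap_rel hτ hn hθ ω) (x * y) =
      ultraLift hτ ω (seqMap θ hn) (seqMap_rel hτ hn hθ ω) x *
        ultraLift hτ ω (seqMap θ hn) (seqMap_rel hτ hn hθ ω) y := by
  obtain ⟨x, rfl⟩ := ultraMk_surjective hτ ω x
  obtain ⟨y, rfl⟩ := ultraMk_surjective hτ ω y
  rw [← ultraMk_mul, ultraLift_mk, ultraLift_mk, ultraLift_mk, ← ultraMk_mul]
  exact congrArg _ (Subtype.ext (funext fun _ => map_mul θ _ _))

/-- The extension `θ^ω` of a trace-preserving automorphism `θ` of `A` to `A^ω`, that is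
`θ^ω ((x n)^ω) = (θ (x n))^ω`. -/
def ultraAut (θ : A ≃⋆ₐ[ℂ] A) (hn : ∀ x, ‖θ x‖ ≤ ‖x‖)
    (hθ : ∀ x, τ (θ x) = τ x) (ω : Ultrafilter ℕ) :
    Ultraproduct hτ ω →⋆ₐ[ℂ] Ultraproduct hτ ω where
  toFun := ultraLift hτ ω (seqMap θ hn) (seqMap_rel hτ hn hθ ω)
  map_one' := by
    rw [← map_one (ultraMk hτ ω), ultraLift_mk]
    exact congrArg _ (Subtype.ext (funext fun _ => map_one θ))
  map_mul' := ultraLift_seqMap_mul hτ hn hθ ω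
  map_zero' := by
    rw [← map_zero (ultraMk hτ ω), ultraLift_mk]
    exact congrArg _ (Subtype.ext (funext fun _ => map_zero θ))
  map_add' := by
    intro x y
    obtain ⟨x, rfl⟩ := ultraMk_surjective hτ ω x
    obtain ⟨y, rfl⟩ := ultraMk_surjective hτ ω y
    rw [← map_add, ultraLift_mk, ultraLift_mk, ultraLift_mk, ← map_add]
    exact congrArg _ (Subtype.ext (funext fun _ => map_add θ _ _))
  commutes' c := by
    rw [← AlgHom.commutes (ultraMk hτ ω) c, ultraLift_mk]
    exact congrArg _ (Subtype.ext (funext fun _ => AlgHomClass.commutes θ c))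
  map_star' := by
    intro x
    obtain ⟨x, rfl⟩ := ultraMk_surjective hτ ω x
    rw [star_ultraMk, ultraLift_mk, ultraLift_mk, star_ultraMk]
    exact congrArg _ (Subtype.ext (funext fun _ => map_star θ _))

/-- A *-algebra is diffuse if it has no minimal projections (atoms): below every non-zero
projection `p` there is a projection `q` different from `0` and `p`. -/
def IsDiffuse (A : Type*) [Ring A] [StarRing A] : Prop :=
  ∀ p : A, IsStarProjection p → p ≠ 0 →
    ∃ q : A, IsStarProjection q ∧ p * q = q ∧ q ≠ 0 ∧ q ≠ p

end Ultra

/-! ### Traces, II₁ factors, irreducible inclusions, relative property gamma -/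

section Basic

variable {K : Type u} [NormedAddCommGroup K] [InnerProductSpace ℂ K] [CompleteSpace K]

/-- A faithful normal tracial state on a von Neumann algebra `Q ⊆ B(K)`. Normality (which contains
positivity) is the usual concrete form: the functional is a countable sum of vector functionals
`x ↦ ⟪ξ n, x (ξ n)⟫` with `∑ ‖ξ n‖² < ∞`. -/
structure FaithfulNormalTrace (Q : VonNeumannAlgebra K) where
  toLin : Q.toStarSubalgebra →ₗ[ℂ] ℂ
  map_one : toLin 1 = 1
  map_mul_comm : ∀ x y, toLin (x * y) = toLin (y * x)
  faithful : ∀ x, toLin (star x * x) = 0 → x = 0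
  normal : ∃ ξ : ℕ → K, Summable (fun n => ‖ξ n‖ ^ 2) ∧
    ∀ x : Q.toStarSubalgebra,
      HasSum (fun n => ⟪ξ n, (x : K →L[ℂ] K) (ξ n)⟫_ℂ) (toLin x)

/-- A type II₁ factor: an infinite-dimensional von Neumann algebra with trivial centre that
carries a faithful normal tracial state (which is then unique). -/
structure IsIIOneFactor (Q : VonNeumannAlgebra K) : Prop where
  factor : ∀ x ∈ Q, x ∈ Q.commutant → ∃ c : ℂ, x = c • (1 : K →L[ℂ] K)
  infinite : ¬ FiniteDimensional ℂ Q.toStarSubalgebra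
  trace : Nonempty (FaithfulNormalTrace Q)

/-- `N` is irreducible in `M`: `N' ∩ M ⊆ N`. -/
def IsIrreducibleIn (N M : VonNeumannAlgebra K) : Prop :=
  ∀ x ∈ M, x ∈ N.commutant → x ∈ N

/-- `N` is an irreducible subfactor of the II₁ factor `M`. -/
structure IsIrreducibleSubfactor (N M : VonNeumannAlgebra K) : Prop where
  le : ∀ x ∈ N, x ∈ M
  sub : IsIIOneFactor N
  ambient : IsIIOneFactor M
  irreducible : IsIrreducibleIn N M

/-- `E` is the `τ`-preserving conditional expectation of `M` onto `N` (regarded as a map with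
values in `M`). -/
structure IsCondExp (N : VonNeumannAlgebra K) {M : VonNeumannAlgebra K}
    (τ : FaithfulNormalTrace M) (E : M.toStarSubalgebra →ₗ[ℂ] M.toStarSubalgebra) : Prop where
  mem : ∀ x, (E x : K →L[ℂ] K) ∈ N
  apply_of_mem : ∀ y : M.toStarSubalgebra, (y : K →L[ℂ] K) ∈ N → E y = y
  bimodule : ∀ x y z : M.toStarSubalgebra, (y : K →L[ℂ] K) ∈ N → (z : K →L[ℂ] K) ∈ N →
    E (y * x * z) = y * E x * z
  positive : ∀ x : M.toStarSubalgebra, (E (star x * x) : K →L[ℂ] K).IsPositive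
  trace : ∀ x, τ.toLin (E x) = τ.toLin x

/-- `N` has property gamma relative to `M ⊇ N`: with respect to the trace `τ` of `M` and the
`τ`-preserving conditional expectation `E` of `M` onto `N`, there is a norm-bounded sequence
`(x n)` in `M` with `‖x n‖₂ = 1`, `E (x n) = 0` and `‖y (x n) - (x n) y‖₂ → 0` for all `y ∈ N`. -/
def HasPropertyGammaRelativeTo (N M : VonNeumannAlgebra K) : Prop :=
  (∀ x ∈ N, x ∈ M) ∧
  ∃ (τ : FaithfulNormalTrace M) (E : M.toStarSubalgebra →ₗ[ℂ] M.toStarSubalgebra),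
    IsCondExp N τ E ∧
    ∃ x : ℕ → M.toStarSubalgebra,
      (∃ C : ℝ, ∀ n, ‖x n‖ ≤ C) ∧
      (∀ n, twoNorm τ.toLin (x n) = 1) ∧
      (∀ n, E (x n) = 0) ∧
      ∀ y : M.toStarSubalgebra, (y : K →L[ℂ] K) ∈ N →
        Tendsto (fun n => twoNorm τ.toLin (y * x n - x n * y)) atTop (𝓝 0)

/-- The von Neumann algebra generated by a set of operators: the bicommutant of `S ∪ S*`. -/
def vnGenerated (S : Set (K →L[ℂ] K)) : VonNeumannAlgebra K where
  toStarSubalgebra :=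
    StarSubalgebra.centralizer ℂ (StarSubalgebra.centralizer ℂ S : Set (K →L[ℂ] K))
  centralizer_centralizer' := by
    change Set.centralizer (Set.centralizer
      ((StarSubalgebra.centralizer ℂ (StarSubalgebra.centralizer ℂ S : Set (K →L[ℂ] K)) :
        StarSubalgebra ℂ (K →L[ℂ] K)) : Set (K →L[ℂ] K))) =
      ((StarSubalgebra.centralizer ℂ (StarSubalgebra.centralizer ℂ S : Set (K →L[ℂ] K)) :
        StarSubalgebra ℂ (K →L[ℂ] K)) : Set (K →L[ℂ] K))
    rw [StarSubalgebra.coe_centralizer_centralizer]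
    simp

/-! ### Automorphisms are contractive, the 2-norm is controlled by the operator norm -/

theorem isClosed_coe (Q : VonNeumannAlgebra K) :
    IsClosed (Q.toStarSubalgebra : Set (K →L[ℂ] K)) := by
  have h : (Q.toStarSubalgebra : Set (K →L[ℂ] K)) =
      Set.centralizer (Set.centralizer (Q : Set (K →L[ℂ] K))) := by simp
  rw [h]
  exact Set.isClosed_centralizer _

theorem norm_aut_le {Q : VonNeumannAlgebra K}
    (θ : Q.toStarSubalgebra ≃⋆ₐ[ℂ] Q.toStarSubalgebra) (x : Q.toStarSubalgebra) :
    ‖θ x‖ ≤ ‖x‖ := by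
  have hc : CompleteSpace Q.toStarSubalgebra := (isClosed_coe Q).completeSpace_coe
  let _ : CStarAlgebra Q.toStarSubalgebra := { }
  exact NonUnitalStarAlgHom.norm_apply_le θ x

variable {Q : VonNeumannAlgebra K} (τ : FaithfulNormalTrace Q)

theorem exists_hasSum_sq : ∃ ξ : ℕ → K, ∀ x : Q.toStarSubalgebra,
    HasSum (fun n => ‖(x : K →L[ℂ] K) (ξ n)‖ ^ 2) (τ.toLin (star x * x)).re := by
  obtain ⟨ξ, -, h⟩ := τ.normal
  refine ⟨ξ, fun x => ?_⟩
  have := Complex.hasSum_re (h (star x * x))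
  convert this using 2 with n
  have h2 : ((star x * x : Q.toStarSubalgebra) : K →L[ℂ] K) (ξ n) =
      ContinuousLinearMap.adjoint (x : K →L[ℂ] K) ((x : K →L[ℂ] K) (ξ n)) := rfl
  rw [h2, ContinuousLinearMap.adjoint_inner_right, inner_self_eq_norm_sq_to_K]
  norm_cast

theorem FaithfulNormalTrace.bounded : IsBoundedTrace τ.toLin where
  map_mul_comm := τ.map_mul_comm
  nonneg x := by
    obtain ⟨ξ, h⟩ := exists_hasSum_sq τ
    exact (h x).nonneg fun n => by positivity
  mul_le a x := by
    obtain ⟨ξ, h⟩ := exists_hasSum_sq τ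
    refine hasSum_le (fun n => ?_) (h (a * x)) ((h x).mul_left _)
    rw [← mul_pow]
    exact pow_le_pow_left₀ (norm_nonneg _) ((a : K →L[ℂ] K).le_opNorm _) 2

end Basic

/-! ### Operators on `ℓ²(H, K)`, the group von Neumann algebra -/

/-- The Hilbert space `ℓ²(H, K)`. -/
abbrev L2 (H : Type v) (K : Type u) [NormedAddCommGroup K] : Type (max u v) :=
  lp (fun _ : H => K) 2

theorem memL2_iff {H : Type v} {K : Type u} [NormedAddCommGroup K] (f : H → K) :
    Memℓp (E := fun _ : H => K) f 2 ↔ Summable fun g => ‖f g‖ ^ 2 := by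
  rw [memℓp_gen_iff (by norm_num)]
  simp

theorem norm_sq_L2 {H : Type v} {K : Type u} [NormedAddCommGroup K] (f : L2 H K) : ‖f‖ ^ 2 = ∑' g, ‖f g‖ ^ 2 := by
  have := lp.norm_rpow_eq_tsum (p := 2) (by norm_num) f
  simpa using this

theorem summable_L2 {H : Type v} {K : Type u} [NormedAddCommGroup K] (f : L2 H K) : Summable fun g => ‖f g‖ ^ 2 :=
  (memL2_iff _).1 (lp.memℓp f)

/-- The diagonal operator `(T ξ)(g) = T_g (ξ g)` of a bounded family `(T_g)` on `ℓ²(H, K)`. -/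
def diagOp {H : Type v} [Group H] {K : Type u} [NormedAddCommGroup K] [InnerProductSpace ℂ K]
    (T : H → K →L[ℂ] K) (C : ℝ) (hT : ∀ g, ‖T g‖ ≤ C) : L2 H K →L[ℂ] L2 H K :=
  have hle : ∀ (ξ : L2 H K) (g : H), ‖T g (ξ g)‖ ^ 2 ≤ C ^ 2 * ‖ξ g‖ ^ 2 := fun ξ g => by
    rw [← mul_pow]
    exact pow_le_pow_left₀ (norm_nonneg _) ((T g).le_of_opNorm_le (hT g) _) 2
  have hs : ∀ ξ : L2 H K, Summable fun g => ‖T g (ξ g)‖ ^ 2 := fun ξ =>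
    Summable.of_nonneg_of_le (fun _ => by positivity) (hle ξ) ((summable_L2 ξ).mul_left _)
  LinearMap.mkContinuous
    { toFun := fun ξ => ⟨fun g => T g (ξ g), (memL2_iff _).2 (hs ξ)⟩
      map_add' := fun ξ η => lp.ext (funext fun g => map_add (T g) (ξ g) (η g))
      map_smul' := fun c ξ => lp.ext (funext fun g => map_smul (T g) c (ξ g)) } C
    (fun ξ => by
      have hC : 0 ≤ C := (norm_nonneg _).trans (hT 1)
      refine le_of_sq_le_sq ?_ (by positivity)
      rw [mul_pow, norm_sq_L2, norm_sq_L2, ← tsum_mul_left]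
      exact (hs ξ).tsum_le_tsum (hle ξ) ((summable_L2 ξ).mul_left _))

theorem memL2_translate {H : Type v} [Group H] {K : Type u} [NormedAddCommGroup K] (h : H)
    (ξ : L2 H K) : Memℓp (E := fun _ : H => K) (fun g => ξ (h⁻¹ * g)) 2 := by
  rw [memL2_iff]
  exact (Equiv.mulLeft h⁻¹).summable_iff (f := fun g => ‖ξ g‖ ^ 2) |>.2 (summable_L2 ξ)

/-- The translation `(λ(h) ξ)(g) = ξ(h⁻¹ g)` on `ℓ²(H, K)`. -/
def leftTranslation {H : Type v} [Group H] (K : Type u) [NormedAddCommGroup K]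
    [InnerProductSpace ℂ K] (h : H) : L2 H K →L[ℂ] L2 H K :=
  LinearMap.mkContinuous
    { toFun := fun ξ => ⟨fun g => ξ (h⁻¹ * g), memL2_translate h ξ⟩
      map_add' := fun ξ η => lp.ext (funext fun g => Pi.add_apply (f := ⇑ξ) (g := ⇑η) _)
      map_smul' := fun c ξ => lp.ext (funext fun g => Pi.smul_apply c (⇑ξ) _) } 1
    (fun ξ => by
      refine le_of_sq_le_sq ?_ (by positivity)
      rw [one_mul, norm_sq_L2, norm_sq_L2]
      exact ((Equiv.mulLeft h⁻¹).tsum_eq fun g => ‖ξ g‖ ^ 2).le)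

theorem diagOp_apply {H : Type v} [Group H] {K : Type u} [NormedAddCommGroup K]
    [InnerProductSpace ℂ K] (T : H → K →L[ℂ] K) (C : ℝ) (hT : ∀ g, ‖T g‖ ≤ C) (ξ : L2 H K) (g : H) :
    diagOp T C hT ξ g = T g (ξ g) := rfl

theorem leftTranslation_apply {H : Type v} [Group H] {K : Type u} [NormedAddCommGroup K]
    [InnerProductSpace ℂ K] (h : H) (ξ : L2 H K) (g : H) :
    leftTranslation K h ξ g = ξ (h⁻¹ * g) := rfl

/-- The group von Neumann algebra `L(H)` acting on `ℓ²(H, K) = ℓ²(H) ⊗ K`, i.e. the von Neumann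
algebra generated by the translations `λ(h)`. For `K = ℂ` it is the bicommutant of the left regular
representation; for general `K` it is the amplification `L(H) ⊗ 1`, the canonical copy of `L(H)`
inside every crossed product `Q ⋊_σ H` with `Q ⊆ B(K)`. -/
def groupVN (H : Type v) [Group H] (K : Type u) [NormedAddCommGroup K] [InnerProductSpace ℂ K]
    [CompleteSpace K] : VonNeumannAlgebra (L2 H K) :=
  vnGenerated (Set.range (leftTranslation (H := H) K))

/-! ### Actions, fixed points, crossed products -/

section Action

variable {K : Type u} [NormedAddCommGroup K] [InnerProductSpace ℂ K] [CompleteSpace K]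
variable {H : Type v} [Group H]

/-- An action of `H` on `Q` by trace-preserving *-automorphisms. -/
structure TraceAction (H : Type v) [Group H] {Q : VonNeumannAlgebra K}
    (τ : FaithfulNormalTrace Q) where
  toHom : H →* (Q.toStarSubalgebra ≃⋆ₐ[ℂ] Q.toStarSubalgebra)
  trace_map : ∀ g x, τ.toLin (toHom g x) = τ.toLin x

variable {Q : VonNeumannAlgebra K} {τ : FaithfulNormalTrace Q} (σ : TraceAction H τ)

/-- The action is ergodic: `Q^σ = ℂ`. -/
def TraceAction.IsErgodic : Prop :=
  ∀ x : Q.toStarSubalgebra, (∀ g, σ.toHom g x = x) →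
    ∃ c : ℂ, x = algebraMap ℂ Q.toStarSubalgebra c

/-- The fixed point algebra `(Q^ω)^σ` of the action `g ↦ (σ_g)^ω` on `Q^ω`. -/
def TraceAction.ultraFixed (ω : Ultrafilter ℕ) : StarSubalgebra ℂ (Ultraproduct τ.bounded ω) where
  carrier := {x | ∀ g, ultraAut τ.bounded (σ.toHom g) (norm_aut_le _) (σ.trace_map g) ω x = x}
  mul_mem' := by
    intro a b ha hb g
    rw [map_mul, ha g, hb g]
  add_mem' := by
    intro a b ha hb g
    rw [map_add, ha g, hb g]
  algebraMap_mem' c g := AlgHomClass.commutes _ c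
  star_mem' := by
    intro a ha g
    rw [map_star, ha g]

/-- The representation of `Q` on `ℓ²(H, K)` given by `(π(x) ξ)(g) = σ_{g⁻¹}(x) (ξ g)`. -/
def TraceAction.rep (x : Q.toStarSubalgebra) : L2 H K →L[ℂ] L2 H K :=
  diagOp (fun g => ((σ.toHom g⁻¹ x : Q.toStarSubalgebra) : K →L[ℂ] K)) ‖x‖
    (fun g => norm_aut_le (σ.toHom g⁻¹) x)

/-- The crossed product `Q ⋊_σ H`: the von Neumann algebra on `ℓ²(H, K)` generated by `π(Q)` and
the translations `λ(h)`, which satisfy `λ(h) π(x) λ(h)* = π(σ_h(x))`. -/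
def TraceAction.crossedProduct : VonNeumannAlgebra (L2 H K) :=
  vnGenerated (Set.range σ.rep ∪ Set.range (leftTranslation (H := H) K))

end Action

/-- `H` is icc: every non-trivial conjugacy class is infinite. -/
def IsICC (H : Type v) [Group H] : Prop :=
  ∀ h : H, h ≠ 1 → (conjugatesOf h).Infinite

end RelGamma

end

noncomputable section

namespace RelGamma

/-! ### Operators on `ℓ²(J, E)` and their matrices -/

section OperatorMatrix

variable {J : Type*} {E : Type*} [NormedAddCommGroup E]

/-! Everything is read off the matrix of an operator on `ℓ²(H, K)`. An element `x` of the crossed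
product has entries in `Q` with `x(gk, hk) = σ_k⁻¹(x(g, h))` (`entry_mem`, `isCovariant`), so its
first column, the family `coeff x g`, determines it. The functional `x ↦ τ(x(1, 1))` satisfies
Parseval's formula `hasSum_coeff`, and from this formula come its faithfulness and its trace
property.

Factors and irreducibility: if `x` commutes with every `λ(k)`, its coefficients along a conjugacy
class differ only by automorphisms `σ_k` and so have equal 2-norm. Since the squares of these norms
are summable and non-trivial classes are infinite, only the coefficient at `1` survives. It is fixed
by `σ`, hence scalar by ergodicity (`IsErgodic.eq_smul_one`). Thus `N' ∩ M = ℂ`, which contains the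
centres of both `N` and `M`.

Relative gamma: a projection other than `0` and `1` in `(Q^ω)^σ` lifts to a bounded sequence. After
subtraction of its traces the sequence is not null along `ω`, because otherwise the projection would
be a scalar idempotent. Normalising and choosing indices diagonally over an enumeration of `H` gives
`x n` in `Q` of trace zero and 2-norm one with `‖σ_h(x n) - x n‖₂ → 0` (`exists_central_sequence`).
The images `π(x n)` then commute asymptotically with each `λ(h)`, and, being bounded, with the
2-norm closure of the group algebra, which contains `L(H)` by the density theorem `exists_approx`.
The expectation onto `L(H)` is the slice map that applies `τ` to each matrix entry
(`exists_condExp`); it sends `π(x n)` to `τ(x n) = 0`. -/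

theorem hasSum_norm_sq (ξ : L2 J E) : HasSum (fun j => ‖ξ j‖ ^ 2) (‖ξ‖ ^ 2) := by
  rw [norm_sq_L2]
  exact (summable_L2 ξ).hasSum

theorem norm_coord_le (j : J) (ξ : L2 J E) : ‖ξ j‖ ≤ ‖ξ‖ :=
  lp.norm_apply_le_norm (by norm_num) ξ j

variable [InnerProductSpace ℂ E]

open Classical in
/-- The embedding of `E` as the `j`-th summand of `ℓ²(J, E)`. -/
def emb (j : J) : E →L[ℂ] L2 J E := lp.singleContinuousLinearMap ℂ (fun _ : J => E) 2 j

/-- The `j`-th coordinate on `ℓ²(J, E)`. -/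
def coord (j : J) : L2 J E →L[ℂ] E := lp.evalCLM ℂ (fun _ : J => E) 2 j

theorem emb_apply_self (j : J) (v : E) : emb j v j = v := by
  classical exact lp.single_apply_self (E := fun _ : J => E) 2 j v

theorem emb_apply_ne {i j : J} (h : i ≠ j) (v : E) : emb j v i = 0 := by
  classical exact lp.single_apply_ne (E := fun _ : J => E) 2 j v h

theorem norm_emb (j : J) (v : E) : ‖emb j v‖ = ‖v‖ := by
  classical exact lp.norm_single (E := fun _ : J => E) (p := 2) (by norm_num) j v

theorem hasSum_emb (ξ : L2 J E) : HasSum (fun j => emb j (ξ j)) ξ := by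
  classical exact lp.hasSum_single (by norm_num) ξ

theorem inner_emb_left (j : J) (v : E) (ξ : L2 J E) : ⟪emb j v, ξ⟫_ℂ = ⟪v, ξ j⟫_ℂ := by
  classical exact lp.inner_single_left (𝕜 := ℂ) (G := fun _ : J => E) j v ξ

theorem inner_emb_right (j : J) (v : E) (ξ : L2 J E) : ⟪ξ, emb j v⟫_ℂ = ⟪ξ j, v⟫_ℂ := by
  classical exact lp.inner_single_right (𝕜 := ℂ) (G := fun _ : J => E) j v ξ

/-- The matrix entry of an operator on `ℓ²(J, E)`. -/
def entry (T : L2 J E →L[ℂ] L2 J E) (g h : J) : E →L[ℂ] E := coord g ∘L T ∘L emb h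

theorem entry_apply (T : L2 J E →L[ℂ] L2 J E) (g h : J) (v : E) :
    entry T g h v = T (emb h v) g := rfl

theorem norm_entry_apply_le (T : L2 J E →L[ℂ] L2 J E) (g h : J) (v : E) :
    ‖entry T g h v‖ ≤ ‖T (emb h v)‖ := norm_coord_le g _

theorem entry_add (S T : L2 J E →L[ℂ] L2 J E) (g h : J) :
    entry (S + T) g h = entry S g h + entry T g h := rfl

theorem entry_sub (S T : L2 J E →L[ℂ] L2 J E) (g h : J) :
    entry (S - T) g h = entry S g h - entry T g h := rfl

theorem entry_smul (c : ℂ) (T : L2 J E →L[ℂ] L2 J E) (g h : J) :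
    entry (c • T) g h = c • entry T g h := rfl

theorem entry_one_self (g : J) : entry (1 : L2 J E →L[ℂ] L2 J E) g g = 1 :=
  ContinuousLinearMap.ext fun v => emb_apply_self g v

theorem entry_one_ne {g h : J} (hgh : g ≠ h) : entry (1 : L2 J E →L[ℂ] L2 J E) g h = 0 :=
  ContinuousLinearMap.ext fun v => emb_apply_ne hgh v

theorem hasSum_entry_apply (T : L2 J E →L[ℂ] L2 J E) (ξ : L2 J E) (g : J) :
    HasSum (fun k => entry T g k (ξ k)) (T ξ g) :=
  (coord g ∘L T).hasSum (hasSum_emb ξ)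

theorem hasSum_entry_mul (S T : L2 J E →L[ℂ] L2 J E) (g h : J) (v : E) :
    HasSum (fun k => entry S g k (entry T k h v)) (entry (S * T) g h v) :=
  hasSum_entry_apply S (T (emb h v)) g

/-- Each vector is the norm-convergent sum of its coordinates, so a continuous operator is recovered
from its matrix. -/
theorem ext_entry {S T : L2 J E →L[ℂ] L2 J E} (h : ∀ i j, entry S i j = entry T i j) : S = T := by
  refine ContinuousLinearMap.ext fun ξ => lp.ext (funext fun i => ?_)
  refine (hasSum_entry_apply S ξ i).unique ?_
  simp only [h]
  exact hasSum_entry_apply T ξ i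

theorem entry_star [CompleteSpace E] (T : L2 J E →L[ℂ] L2 J E) (g h : J) :
    entry (star T) g h = star (entry T h g) := by
  refine ContinuousLinearMap.ext fun v => ext_inner_left ℂ fun w => ?_
  rw [ContinuousLinearMap.star_eq_adjoint (entry T h g), ContinuousLinearMap.adjoint_inner_right,
    entry_apply, entry_apply, ← inner_emb_left, ← inner_emb_right,
    ContinuousLinearMap.star_eq_adjoint, ContinuousLinearMap.adjoint_inner_right]

theorem inner_emb_apply (T : L2 J E →L[ℂ] L2 J E) (j : J) (v w : E) :
    ⟪emb j v, T (emb j w)⟫_ℂ = ⟪v, entry T j j w⟫_ℂ := inner_emb_left j v _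

variable {F : Type*} [NormedAddCommGroup F] [InnerProductSpace ℂ F]

/-- The column operator `v ↦ (T j v)_j` with values in `ℓ²(J, F)`. -/
def columnOp (T : J → E →L[ℂ] F) (C : ℝ) (hC : 0 ≤ C) (hs : ∀ v, Summable fun j => ‖T j v‖ ^ 2)
    (hb : ∀ v, ∑' j, ‖T j v‖ ^ 2 ≤ C ^ 2 * ‖v‖ ^ 2) : E →L[ℂ] L2 J F :=
  LinearMap.mkContinuous
    { toFun := fun v => ⟨fun j => T j v, (memL2_iff _).2 (hs v)⟩
      map_add' := fun v w => lp.ext (funext fun j => map_add (T j) v w)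
      map_smul' := fun c v => lp.ext (funext fun j => map_smul (T j) c v) } C
    (fun v => by
      refine le_of_sq_le_sq ?_ (by positivity)
      rw [mul_pow, norm_sq_L2]
      exact hb v)

theorem norm_apply_sq_le (x : E →L[ℂ] F) (v : E) : ‖x v‖ ^ 2 ≤ ‖x‖ ^ 2 * ‖v‖ ^ 2 := by
  rw [← mul_pow]
  exact pow_le_pow_left₀ (norm_nonneg _) (x.le_opNorm v) 2

theorem summable_norm_apply_sq (x : E →L[ℂ] F) {η : J → E} (hη : Summable fun j => ‖η j‖ ^ 2) :
    Summable fun j => ‖x (η j)‖ ^ 2 :=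
  Summable.of_nonneg_of_le (fun _ => by positivity) (fun j => norm_apply_sq_le x (η j))
    (hη.mul_left _)

/-- The amplification `1 ⊗ x` of `x` to `ℓ²(J, E)`. -/
def ampl (J : Type*) (x : E →L[ℂ] E) : L2 J E →L[ℂ] L2 J E :=
  columnOp (fun j => x ∘L coord j) ‖x‖ (norm_nonneg x)
    (fun ζ => summable_norm_apply_sq x (summable_L2 ζ))
    (fun ζ => by
      rw [norm_sq_L2, ← tsum_mul_left]
      exact (summable_norm_apply_sq x (summable_L2 ζ)).tsum_le_tsum
        (fun j => norm_apply_sq_le x (ζ j)) ((summable_L2 ζ).mul_left _))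

theorem ampl_apply (x : E →L[ℂ] E) (ζ : L2 J E) (j : J) : ampl J x ζ j = x (ζ j) := rfl

theorem ampl_emb (x : E →L[ℂ] E) (j : J) (v : E) : ampl J x (emb j v) = emb j (x v) := by
  refine lp.ext (funext fun i => ?_)
  rw [ampl_apply]
  obtain rfl | h := eq_or_ne i j
  · rw [emb_apply_self, emb_apply_self]
  · rw [emb_apply_ne h, emb_apply_ne h, map_zero]

theorem ampl_mul (x y : E →L[ℂ] E) : ampl J (x * y) = ampl J x * ampl J y := rfl

theorem ampl_add (x y : E →L[ℂ] E) : ampl J (x + y) = ampl J x + ampl J y := rfl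

theorem ampl_smul (c : ℂ) (x : E →L[ℂ] E) : ampl J (c • x) = c • ampl J x := rfl

theorem entry_ampl_mul (x : E →L[ℂ] E) (T : L2 J E →L[ℂ] L2 J E) (g h : J) :
    entry (ampl J x * T) g h = x * entry T g h := rfl

theorem entry_mul_ampl (x : E →L[ℂ] E) (T : L2 J E →L[ℂ] L2 J E) (g h : J) :
    entry (T * ampl J x) g h = entry T g h * x :=
  ContinuousLinearMap.ext fun v => by
    change T (ampl J x (emb h v)) g = T (emb h (x v)) g
    rw [ampl_emb]

/-- The matrix of `1 ⊗ x` is `x` along the diagonal and zero elsewhere, so multiplying by it on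
either side acts entry by entry. -/
theorem commute_ampl_iff {x : E →L[ℂ] E} {T : L2 J E →L[ℂ] L2 J E} :
    Commute (ampl J x) T ↔ ∀ g h, Commute x (entry T g h) := by
  constructor
  · intro hc g h
    have := congrArg (fun S => entry S g h) hc.eq
    rwa [entry_ampl_mul, entry_mul_ampl] at this
  · intro hc
    refine ext_entry fun g h => ?_
    rw [entry_ampl_mul, entry_mul_ampl]
    exact hc g h

theorem star_ampl [CompleteSpace E] (x : E →L[ℂ] E) : star (ampl J x) = ampl J (star x) := by
  have key : ∀ (y : E →L[ℂ] E) (g h : J), entry (ampl J y) g h =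
      y * entry (1 : L2 J E →L[ℂ] L2 J E) g h := fun y g h => by
    rw [← entry_ampl_mul, mul_one]
  refine ext_entry fun g h => ?_
  rw [entry_star, key, key]
  obtain rfl | hgh := eq_or_ne g h
  · rw [entry_one_self, mul_one, mul_one]
  · rw [entry_one_ne hgh, entry_one_ne hgh.symm, mul_zero, mul_zero, star_zero]

end OperatorMatrix

/-! ### Approximation in the ultrastrong topology -/

section Density

variable {E : Type*} [NormedAddCommGroup E] [InnerProductSpace ℂ E] [CompleteSpace E]

/-- The ultrastrong form of von Neumann's density theorem: if `A` is a subspace that contains `1`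
and is stable under left multiplication by a self-adjoint set `S`, then each element of `S''` is
approximated by elements of `A` on every square-summable family of vectors. -/
theorem exists_approx {S : Set (E →L[ℂ] E)} (hS : ∀ s ∈ S, star s ∈ S)
    (A : Submodule ℂ (E →L[ℂ] E)) (h1 : 1 ∈ A) (hA : ∀ s ∈ S, ∀ a ∈ A, s * a ∈ A)
    {x : E →L[ℂ] E} (hx : ∀ t, (∀ s ∈ S, Commute s t) → Commute x t)
    {J : Type*} {η : J → E} (hη : Summable fun j => ‖η j‖ ^ 2) {ε : ℝ} (hε : 0 < ε) :
    ∃ a ∈ A, ∑' j, ‖(x - a) (η j)‖ ^ 2 < ε := by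
  let ζ : L2 J E := ⟨η, (memL2_iff _).2 hη⟩
  let ev : (E →L[ℂ] E) →ₗ[ℂ] L2 J E :=
    { toFun := fun a => ampl J a ζ
      map_add' := fun a b => rfl
      map_smul' := fun c a => rfl }
  -- Amplification turns the whole family `η` into one vector `ζ`. The claim becomes that `(1 ⊗ x)
  -- ζ` lies in the closure of `(1 ⊗ A) ζ`.
  let V : Submodule ℂ (L2 J E) := (A.map ev).topologicalClosure
  have : CompleteSpace V := (Submodule.isClosed_topologicalClosure _).completeSpace_coe
  have hV : ∀ s ∈ S, ∀ v ∈ V, ampl J s v ∈ V := by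
    intro s hs v hv
    refine map_mem_closure (ampl J s).continuous hv ?_
    rintro _ ⟨a, ha, rfl⟩
    exact ⟨s * a, hA s hs a ha, rfl⟩
  -- `V` is invariant under `1 ⊗ s` and, as `S` is self-adjoint, under its adjoint; hence it reduces
  -- `1 ⊗ s`.
  have hP : ∀ s ∈ S, Commute (ampl J s) V.starProjection := by
    intro s hs
    refine ContinuousLinearMap.ext fun v => ?_
    change ampl J s (V.starProjection v) = V.starProjection (ampl J s v)
    symm
    refine Submodule.eq_starProjection_of_mem_of_inner_eq_zero
      (hV s hs _ (Submodule.starProjection_apply_mem V v)) fun w hw => ?_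
    rw [← map_sub, ← ContinuousLinearMap.adjoint_inner_right,
      ← ContinuousLinearMap.star_eq_adjoint, star_ampl]
    exact Submodule.starProjection_inner_eq_zero v _ (hV _ (hS s hs) w hw)
  -- The entries of the projection commute with `S`, so they commute with `x` by the bicommutant
  -- hypothesis.
  have hx' : Commute (ampl J x) V.starProjection :=
    commute_ampl_iff.2 fun g h => hx _ fun s hs => commute_ampl_iff.1 (hP s hs) g h
  have hζ : ζ ∈ V := Submodule.le_topologicalClosure _ ⟨1, h1, rfl⟩
  have hxζ : ampl J x ζ ∈ V := by
    have h2 : ampl J x (V.starProjection ζ) = V.starProjection (ampl J x ζ) :=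
      congrArg (fun T => T ζ) hx'.eq
    rw [Submodule.starProjection_eq_self_iff.2 hζ] at h2
    rw [h2]
    exact Submodule.starProjection_apply_mem V _
  obtain ⟨_, ⟨a, ha, rfl⟩, hd⟩ := Metric.mem_closure_iff.1 hxζ (Real.sqrt ε) (Real.sqrt_pos.2 hε)
  refine ⟨a, ha, ?_⟩
  have h3 : ‖ampl J x ζ - ampl J a ζ‖ ^ 2 < ε := by
    rw [← Real.lt_sqrt (norm_nonneg _), ← dist_eq_norm]
    exact hd
  rwa [norm_sq_L2] at h3

end Density

/-! ### The generators of crossed products -/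

section Generated

variable {E : Type*} [NormedAddCommGroup E] [InnerProductSpace ℂ E] [CompleteSpace E]

/-- Star-centralizers ask for commutation with adjoints as well; for a self-adjoint `S` this is
automatic, and a plain bicommutant remains. -/
theorem mem_vnGenerated_iff {S : Set (E →L[ℂ] E)} (hS : ∀ s ∈ S, star s ∈ S) {x : E →L[ℂ] E} :
    x ∈ vnGenerated S ↔ ∀ t, (∀ s ∈ S, Commute s t) → Commute x t := by
  have h1 : x ∈ vnGenerated S ↔
      x ∈ StarSubalgebra.centralizer ℂ (StarSubalgebra.centralizer ℂ S : Set (E →L[ℂ] E)) := Iff.rfl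
  have h2 : ∀ t, t ∈ StarSubalgebra.centralizer ℂ S ↔ ∀ s ∈ S, Commute s t := fun t => by
    rw [StarSubalgebra.mem_centralizer_iff]
    exact ⟨fun h s hs => (h s hs).1, fun h s hs => ⟨h s hs, h _ (hS s hs)⟩⟩
  rw [h1, StarSubalgebra.mem_centralizer_iff]
  constructor
  · intro h t ht
    exact (h t ((h2 t).2 ht)).1.symm
  · intro h t ht
    exact ⟨(h t ((h2 t).1 ht)).eq.symm, (h _ ((h2 _).1 (star_mem ht))).eq.symm⟩

theorem subset_vnGenerated {S : Set (E →L[ℂ] E)} (hS : ∀ s ∈ S, star s ∈ S) {x : E →L[ℂ] E}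
    (hx : x ∈ S) : x ∈ vnGenerated S :=
  (mem_vnGenerated_iff hS).2 fun _ ht => ht x hx

end Generated

/-! ### Translations and the group algebra on `ℓ²(H, K)` -/

section Translation

variable {H : Type*} [Group H] {K : Type*} [NormedAddCommGroup K] [InnerProductSpace ℂ K]

theorem leftTranslation_one : leftTranslation (H := H) K 1 = 1 := by
  refine ContinuousLinearMap.ext fun ξ => lp.ext (funext fun g => ?_)
  rw [leftTranslation_apply, inv_one, one_mul]
  rfl

theorem leftTranslation_mul (g h : H) :
    leftTranslation K g * leftTranslation K h = leftTranslation K (g * h) := by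
  refine ContinuousLinearMap.ext fun ξ => lp.ext (funext fun k => ?_)
  change ξ (h⁻¹ * (g⁻¹ * k)) = ξ ((g * h)⁻¹ * k)
  rw [mul_inv_rev, mul_assoc]

theorem leftTranslation_emb (k h : H) (v : K) :
    leftTranslation K k (emb h v) = emb (k * h) v := by
  refine lp.ext (funext fun g => ?_)
  rw [leftTranslation_apply]
  obtain rfl | hg := eq_or_ne g (k * h)
  · rw [inv_mul_cancel_left, emb_apply_self, emb_apply_self]
  · rw [emb_apply_ne hg, emb_apply_ne fun h' => hg (inv_mul_eq_iff_eq_mul.1 h')]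

theorem entry_leftTranslation_mul (k : H) (T : L2 H K →L[ℂ] L2 H K) (g h : H) :
    entry (leftTranslation K k * T) g h = entry T (k⁻¹ * g) h := rfl

theorem entry_mul_leftTranslation (k : H) (T : L2 H K →L[ℂ] L2 H K) (g h : H) :
    entry (T * leftTranslation K k) g h = entry T g (k * h) :=
  ContinuousLinearMap.ext fun v => by
    change T (leftTranslation K k (emb h v)) g = T (emb (k * h) v) g
    rw [leftTranslation_emb]

/-- Conjugation by `λ(k)` shifts both matrix indices by `k`. -/
theorem commute_leftTranslation_iff {k : H} {T : L2 H K →L[ℂ] L2 H K} :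
    Commute (leftTranslation K k) T ↔ ∀ g h, entry T (k * g) (k * h) = entry T g h := by
  constructor
  · intro hc g h
    have := congrArg (fun S => entry S (k * g) h) hc.eq
    rw [entry_leftTranslation_mul, entry_mul_leftTranslation, inv_mul_cancel_left] at this
    exact this.symm
  · intro hT
    refine ext_entry fun g h => ?_
    rw [entry_leftTranslation_mul, entry_mul_leftTranslation, ← hT, mul_inv_cancel_left]

variable (H K) in
/-- The span of the translations, i.e. the group algebra of `H`. -/
def groupAlgebra : Submodule ℂ (L2 H K →L[ℂ] L2 H K) :=
  Submodule.span ℂ (Set.range (leftTranslation K))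

theorem mul_mem_groupAlgebra : ∀ s ∈ Set.range (leftTranslation (H := H) K),
    ∀ a ∈ groupAlgebra H K, s * a ∈ groupAlgebra H K := by
  rintro _ ⟨k, rfl⟩ a ha
  have hle : groupAlgebra H K ≤
      (groupAlgebra H K).comap (LinearMap.mulLeft ℂ (leftTranslation K k)) := by
    refine Submodule.span_le.2 ?_
    rintro _ ⟨l, rfl⟩
    exact Submodule.subset_span ⟨k * l, (leftTranslation_mul k l).symm⟩
  exact hle ha

variable [CompleteSpace K]

theorem star_leftTranslation (k : H) :
    star (leftTranslation K k) = leftTranslation K k⁻¹ := by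
  refine ext_entry fun g h => ?_
  rw [entry_star, ← mul_one (leftTranslation K k), ← mul_one (leftTranslation K k⁻¹),
    entry_leftTranslation_mul, entry_leftTranslation_mul, inv_inv]
  obtain rfl | hg := eq_or_ne h (k * g)
  · rw [inv_mul_cancel_left, entry_one_self, entry_one_self, star_one]
  · rw [entry_one_ne hg.symm, entry_one_ne fun h' => hg (inv_mul_eq_iff_eq_mul.1 h'), star_zero]

theorem star_mem_range_leftTranslation :
    ∀ s ∈ Set.range (leftTranslation (H := H) K),
      star s ∈ Set.range (leftTranslation (H := H) K) := by
  rintro _ ⟨k, rfl⟩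
  exact ⟨k⁻¹, (star_leftTranslation k).symm⟩

theorem mem_groupVN_iff {x : L2 H K →L[ℂ] L2 H K} :
    x ∈ groupVN H K ↔ ∀ t, (∀ k : H, Commute (leftTranslation K k) t) → Commute x t := by
  rw [groupVN, mem_vnGenerated_iff star_mem_range_leftTranslation]
  simp only [Set.forall_mem_range]

theorem leftTranslation_mem_groupVN (k : H) : leftTranslation K k ∈ groupVN H K :=
  subset_vnGenerated star_mem_range_leftTranslation ⟨k, rfl⟩

theorem commute_ampl_of_mem_groupVN {x : L2 H K →L[ℂ] L2 H K} (hx : x ∈ groupVN H K)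
    (t : K →L[ℂ] K) : Commute x (ampl H t) :=
  mem_groupVN_iff.1 hx _ fun _ => rfl

end Translation

/-! ### Traces and the 2-norm -/

section Trace

variable {K : Type*} [NormedAddCommGroup K] [InnerProductSpace ℂ K] [CompleteSpace K]
variable {Q : VonNeumannAlgebra K} (τ : FaithfulNormalTrace Q)

theorem inner_star_mul_self (x : Q.toStarSubalgebra) (ξ : K) :
    ⟪ξ, ((star x * x : Q.toStarSubalgebra) : K →L[ℂ] K) ξ⟫_ℂ =
      ((‖(x : K →L[ℂ] K) ξ‖ ^ 2 : ℝ) : ℂ) := by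
  have h : ((star x * x : Q.toStarSubalgebra) : K →L[ℂ] K) ξ =
      ContinuousLinearMap.adjoint (x : K →L[ℂ] K) ((x : K →L[ℂ] K) ξ) := rfl
  rw [h, ContinuousLinearMap.adjoint_inner_right, inner_self_eq_norm_sq_to_K]
  norm_cast

/-- The vectors that implement a normal trace, with the induced formula for `‖x‖₂²`. -/
theorem exists_vectors : ∃ ξ : ℕ → K, Summable (fun n => ‖ξ n‖ ^ 2) ∧
    (∀ x : Q.toStarSubalgebra, HasSum (fun n => ⟪ξ n, (x : K →L[ℂ] K) (ξ n)⟫_ℂ) (τ.toLin x)) ∧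
    ∀ x : Q.toStarSubalgebra,
      HasSum (fun n => ‖(x : K →L[ℂ] K) (ξ n)‖ ^ 2) (τ.toLin (star x * x)).re := by
  obtain ⟨ξ, hs, h⟩ := τ.normal
  refine ⟨ξ, hs, h, fun x => ?_⟩
  have := Complex.hasSum_re (h (star x * x))
  simpa only [inner_star_mul_self, Complex.ofReal_re] using this

theorem toLin_star_mul_self (x : Q.toStarSubalgebra) :
    τ.toLin (star x * x) = ((τ.toLin (star x * x)).re : ℂ) := by
  obtain ⟨ξ, -, h, h'⟩ := exists_vectors τ
  have := h (star x * x)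
  simp only [inner_star_mul_self] at this
  exact this.unique (Complex.hasSum_ofReal.2 (h' x))

/-- Lets identities in `Q` be proved by 2-norm approximation. -/
theorem eq_zero_of_sq_le {z : Q.toStarSubalgebra}
    (hz : ∀ ε > 0, (τ.toLin (star z * z)).re ≤ ε) : z = 0 := by
  refine τ.faithful z ?_
  rw [toLin_star_mul_self, le_antisymm (le_of_forall_pos_le_add fun ε hε => by
    simpa using hz ε hε) (τ.bounded.nonneg z), Complex.ofReal_zero]

theorem sq_sub_le (x y : Q.toStarSubalgebra) : (τ.toLin (star (x - y) * (x - y))).re ≤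
    2 * (τ.toLin (star x * x)).re + 2 * (τ.toLin (star y * y)).re := by
  have := sq_add_le τ.bounded x (-y)
  rwa [← sub_eq_add_neg, star_neg, neg_mul_neg] at this

end Trace

/-! ### Matrix entries of elements of the crossed product -/

section Crossed

variable {K : Type*} [NormedAddCommGroup K] [InnerProductSpace ℂ K] [CompleteSpace K]
variable {H : Type*} [Group H] {Q : VonNeumannAlgebra K} {τ : FaithfulNormalTrace Q}
variable (σ : TraceAction H τ)

namespace TraceAction

theorem toHom_mul_apply (g h : H) (a : Q.toStarSubalgebra) :
    σ.toHom (g * h) a = σ.toHom g (σ.toHom h a) := by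
  rw [map_mul]
  rfl

theorem toHom_one_apply (a : Q.toStarSubalgebra) : σ.toHom 1 a = a := by
  rw [map_one]
  rfl

theorem trace_star_mul_self (g : H) (a : Q.toStarSubalgebra) :
    τ.toLin (star (σ.toHom g a) * σ.toHom g a) = τ.toLin (star a * a) := by
  rw [← map_star, ← map_mul, σ.trace_map]

theorem rep_apply (a : Q.toStarSubalgebra) (ξ : L2 H K) (g : H) :
    σ.rep a ξ g = (σ.toHom g⁻¹ a : K →L[ℂ] K) (ξ g) := rfl

theorem norm_rep_le (a : Q.toStarSubalgebra) : ‖σ.rep a‖ ≤ ‖a‖ := by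
  unfold rep diagOp
  exact LinearMap.mkContinuous_norm_le _ (norm_nonneg a) _

theorem entry_rep_mul (a : Q.toStarSubalgebra) (T : L2 H K →L[ℂ] L2 H K) (g h : H) :
    entry (σ.rep a * T) g h = (σ.toHom g⁻¹ a : K →L[ℂ] K) * entry T g h := rfl

theorem entry_rep_self (a : Q.toStarSubalgebra) (g : H) :
    entry (σ.rep a) g g = (σ.toHom g⁻¹ a : K →L[ℂ] K) := by
  rw [← mul_one (σ.rep a), entry_rep_mul, entry_one_self, mul_one]

theorem entry_rep_ne (a : Q.toStarSubalgebra) {g h : H} (hgh : g ≠ h) :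
    entry (σ.rep a) g h = 0 := by
  rw [← mul_one (σ.rep a), entry_rep_mul, entry_one_ne hgh, mul_zero]

theorem rep_mul (a b : Q.toStarSubalgebra) : σ.rep (a * b) = σ.rep a * σ.rep b := by
  refine ContinuousLinearMap.ext fun ξ => lp.ext (funext fun g => ?_)
  rw [rep_apply, map_mul]
  rfl

theorem rep_one : σ.rep 1 = 1 := by
  refine ContinuousLinearMap.ext fun ξ => lp.ext (funext fun g => ?_)
  rw [rep_apply, map_one]
  rfl

theorem rep_sub (a b : Q.toStarSubalgebra) : σ.rep (a - b) = σ.rep a - σ.rep b := by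
  refine ContinuousLinearMap.ext fun ξ => lp.ext (funext fun g => ?_)
  rw [rep_apply, map_sub]
  rfl

theorem star_rep (a : Q.toStarSubalgebra) : star (σ.rep a) = σ.rep (star a) := by
  refine ext_entry fun g h => ?_
  rw [entry_star]
  obtain rfl | hgh := eq_or_ne g h
  · rw [entry_rep_self, entry_rep_self, map_star]
    rfl
  · rw [entry_rep_ne σ a hgh.symm, entry_rep_ne σ _ hgh, star_zero]

theorem leftTranslation_mul_rep (k : H) (a : Q.toStarSubalgebra) :
    leftTranslation K k * σ.rep a = σ.rep (σ.toHom k a) * leftTranslation K k := by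
  refine ContinuousLinearMap.ext fun ξ => lp.ext (funext fun g => ?_)
  change (σ.toHom (k⁻¹ * g)⁻¹ a : K →L[ℂ] K) (ξ (k⁻¹ * g)) =
    (σ.toHom g⁻¹ (σ.toHom k a) : K →L[ℂ] K) (ξ (k⁻¹ * g))
  rw [← toHom_mul_apply, mul_inv_rev, inv_inv]

theorem star_mem_generators :
    ∀ s ∈ Set.range σ.rep ∪ Set.range (leftTranslation (H := H) K),
      star s ∈ Set.range σ.rep ∪ Set.range (leftTranslation (H := H) K) := by
  rintro _ (⟨a, rfl⟩ | ⟨k, rfl⟩)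
  · exact Or.inl ⟨star a, (star_rep σ a).symm⟩
  · exact Or.inr ⟨k⁻¹, (star_leftTranslation k).symm⟩

theorem rep_mem (a : Q.toStarSubalgebra) : σ.rep a ∈ σ.crossedProduct :=
  subset_vnGenerated σ.star_mem_generators (Or.inl ⟨a, rfl⟩)

theorem leftTranslation_mem (k : H) : leftTranslation K k ∈ σ.crossedProduct :=
  subset_vnGenerated σ.star_mem_generators (Or.inr ⟨k, rfl⟩)

theorem groupVN_le {x : L2 H K →L[ℂ] L2 H K} (hx : x ∈ groupVN H K) : x ∈ σ.crossedProduct :=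
  (mem_vnGenerated_iff σ.star_mem_generators).2 fun t ht =>
    mem_groupVN_iff.1 hx t fun k => ht _ (Or.inr ⟨k, rfl⟩)

/-- For `t ∈ Q'` the operator `1 ⊗ t` commutes with `π(Q)` and with all translations, hence with
`x`. So the entries of `x` lie in `Q'' = Q`. -/
theorem entry_mem {x : L2 H K →L[ℂ] L2 H K} (hx : x ∈ σ.crossedProduct) (g h : H) :
    entry x g h ∈ Q := by
  rw [← Q.commutant_commutant, VonNeumannAlgebra.mem_commutant_iff]
  intro t ht
  refine commute_ampl_iff.1 (Commute.symm ?_) g h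
  refine (mem_vnGenerated_iff σ.star_mem_generators).1 hx _ ?_
  rintro _ (⟨a, rfl⟩ | ⟨k, rfl⟩)
  · refine ContinuousLinearMap.ext fun ξ => lp.ext (funext fun k => ?_)
    have := VonNeumannAlgebra.mem_commutant_iff.1 ht _ (σ.toHom k⁻¹ a).2
    exact congrArg (fun T => T (ξ k)) this
  · rfl

/-- The span of the products `π(a) λ(h)`. -/
def polynomials : Submodule ℂ (L2 H K →L[ℂ] L2 H K) :=
  Submodule.span ℂ (Set.range fun p : Q.toStarSubalgebra × H => σ.rep p.1 * leftTranslation K p.2)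

theorem one_mem_polynomials : 1 ∈ σ.polynomials :=
  Submodule.subset_span ⟨(1, 1), by
    change σ.rep 1 * leftTranslation K 1 = 1
    rw [rep_one, leftTranslation_one, mul_one]⟩

theorem mul_mem_polynomials : ∀ s ∈ Set.range σ.rep ∪ Set.range (leftTranslation (H := H) K),
    ∀ a ∈ σ.polynomials, s * a ∈ σ.polynomials := by
  intro s hs a ha
  have hle : σ.polynomials ≤ σ.polynomials.comap (LinearMap.mulLeft ℂ s) := by
    refine Submodule.span_le.2 ?_
    rintro _ ⟨⟨b, k⟩, rfl⟩
    refine Submodule.subset_span ?_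
    obtain ⟨c, rfl⟩ | ⟨g, rfl⟩ := hs
    · refine ⟨(c * b, k), ?_⟩
      change σ.rep (c * b) * leftTranslation K k = σ.rep c * (σ.rep b * leftTranslation K k)
      rw [rep_mul, mul_assoc]
    · refine ⟨(σ.toHom g b, g * k), ?_⟩
      change σ.rep (σ.toHom g b) * leftTranslation K (g * k) =
        leftTranslation K g * (σ.rep b * leftTranslation K k)
      rw [← mul_assoc, leftTranslation_mul_rep, mul_assoc, leftTranslation_mul]
  exact hle ha

/-- An operator on `ℓ²(H, K)` is covariant if its matrix entries `x (g, h)` are in `Q` and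
satisfy `x (g k, h k) = σ_k⁻¹ (x (g, h))`. -/
def IsCovariant (x : L2 H K →L[ℂ] L2 H K) : Prop :=
  ∀ g h k, ∃ c : Q.toStarSubalgebra, entry x g h = (c : K →L[ℂ] K) ∧
    entry x (g * k) (h * k) = (σ.toHom k⁻¹ c : K →L[ℂ] K)

/-- Covariance is linear in `x`, so it suffices to treat `π(a) λ(l)`, whose entry at `(g, h)` is
`σ_{g⁻¹}(a)` if `g = l h` and zero otherwise. -/
theorem isCovariant_of_mem_polynomials {x : L2 H K →L[ℂ] L2 H K} (hx : x ∈ σ.polynomials) :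
    σ.IsCovariant x := by
  induction hx using Submodule.span_induction with
  | mem x hx =>
    obtain ⟨⟨a, l⟩, rfl⟩ := hx
    intro g h k
    change ∃ c : Q.toStarSubalgebra,
      (σ.toHom g⁻¹ a : K →L[ℂ] K) * entry (leftTranslation K l) g h = _ ∧
      (σ.toHom (g * k)⁻¹ a : K →L[ℂ] K) * entry (leftTranslation K l) (g * k) (h * k) = _
    rw [← mul_one (leftTranslation K l), entry_leftTranslation_mul, entry_leftTranslation_mul]
    obtain rfl | hgh := eq_or_ne g (l * h)
    · refine ⟨σ.toHom (l * h)⁻¹ a, ?_, ?_⟩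
      · rw [inv_mul_cancel_left, entry_one_self, mul_one]
      · rw [mul_assoc, inv_mul_cancel_left, entry_one_self, mul_one, ← toHom_mul_apply,
          ← mul_assoc, mul_inv_rev (l * h)]
    · refine ⟨0, ?_, ?_⟩
      · rw [entry_one_ne fun h' => hgh (inv_mul_eq_iff_eq_mul.1 h'), mul_zero]
        rfl
      · rw [entry_one_ne fun h' => hgh (mul_right_cancel (b := k) ?_), mul_zero, map_zero]
        · rfl
        · rw [mul_assoc l, ← inv_mul_eq_iff_eq_mul, h']
  | zero => exact fun g h k => ⟨0, rfl, by rw [map_zero]; rfl⟩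
  | add x y _ _ hx hy =>
    intro g h k
    obtain ⟨c, hc, hc'⟩ := hx g h k
    obtain ⟨d, hd, hd'⟩ := hy g h k
    refine ⟨c + d, ?_, ?_⟩
    · rw [entry_add, hc, hd]
      rfl
    · rw [entry_add, hc', hd', map_add]
      rfl
  | smul z x _ hx =>
    intro g h k
    obtain ⟨c, hc, hc'⟩ := hx g h k
    refine ⟨z • c, ?_, ?_⟩
    · rw [entry_smul, hc]
      rfl
    · rw [entry_smul, hc', map_smul]
      rfl

/-- Covariance passes from polynomials to the von Neumann algebra by 2-norm approximation: one
polynomial approximates both entries at once, and `σ_k⁻¹` is a 2-norm isometry. -/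
theorem isCovariant {x : L2 H K →L[ℂ] L2 H K} (hx : x ∈ σ.crossedProduct) : σ.IsCovariant x := by
  intro g h k
  refine ⟨⟨entry x g h, σ.entry_mem hx g h⟩, rfl, ?_⟩
  set c : Q.toStarSubalgebra := ⟨entry x g h, σ.entry_mem hx g h⟩
  let d : Q.toStarSubalgebra := ⟨entry x (g * k) (h * k), σ.entry_mem hx _ _⟩
  suffices hz : d - σ.toHom k⁻¹ c = 0 from congrArg Subtype.val (sub_eq_zero.1 hz)
  refine eq_zero_of_sq_le τ fun ε hε => ?_
  obtain ⟨ξ, hs, -, hsq⟩ := exists_vectors τ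
  -- The vectors `ξ n` implement `τ`. Placed at `h` and at `h * k`, they make the error of the
  -- approximation dominate the squared 2-norm errors of the entries in columns `h` and `h * k`.
  let η : ℕ ⊕ ℕ → L2 H K := Sum.elim (fun n => emb h (ξ n)) (fun n => emb (h * k) (ξ n))
  have hη : Summable fun j => ‖η j‖ ^ 2 := by
    refine (HasSum.sum (f := fun j => ‖η j‖ ^ 2) (a := ∑' n, ‖ξ n‖ ^ 2)
      (b := ∑' n, ‖ξ n‖ ^ 2) ?_ ?_).summable
    · simpa [η, Function.comp_def, norm_emb] using hs.hasSum
    · simpa [η, Function.comp_def, norm_emb] using hs.hasSum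
  obtain ⟨a, ha, hlt⟩ := exists_approx σ.star_mem_generators σ.polynomials σ.one_mem_polynomials
    σ.mul_mem_polynomials ((mem_vnGenerated_iff σ.star_mem_generators).1 hx) hη
    (ε := ε / 4) (by positivity)
  have hsum := summable_norm_apply_sq (x - a) hη
  obtain ⟨c', hc, hd⟩ := σ.isCovariant_of_mem_polynomials ha g h k
  have h1 : (τ.toLin (star (c - c') * (c - c'))).re ≤ ε / 4 := by
    refine le_trans ?_ hlt.le
    rw [← (hsq (c - c')).tsum_eq]
    refine (hsq (c - c')).summable.tsum_le_tsum_of_inj Sum.inl Sum.inl_injective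
      (fun _ _ => by positivity) (fun n => ?_) hsum
    have : ((c - c' : Q.toStarSubalgebra) : K →L[ℂ] K) = entry (x - a) g h := by
      rw [entry_sub, hc]
      rfl
    rw [this]
    exact pow_le_pow_left₀ (norm_nonneg _) (norm_entry_apply_le (x - a) g h _) 2
  have h2 : (τ.toLin (star (d - σ.toHom k⁻¹ c') * (d - σ.toHom k⁻¹ c'))).re ≤ ε / 4 := by
    refine le_trans ?_ hlt.le
    rw [← (hsq (d - σ.toHom k⁻¹ c')).tsum_eq]
    refine (hsq (d - σ.toHom k⁻¹ c')).summable.tsum_le_tsum_of_inj Sum.inr Sum.inr_injective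
      (fun _ _ => by positivity) (fun n => ?_) hsum
    have : ((d - σ.toHom k⁻¹ c' : Q.toStarSubalgebra) : K →L[ℂ] K) =
        entry (x - a) (g * k) (h * k) := by
      rw [entry_sub, hd]
      rfl
    rw [this]
    exact pow_le_pow_left₀ (norm_nonneg _) (norm_entry_apply_le (x - a) _ _ _) 2
  -- With `d - σ_k⁻¹(c) = (d - σ_k⁻¹(c')) - σ_k⁻¹(c - c')`, two errors of `ε / 4`, each doubled, add
  -- up to `ε`.
  have h3 := sq_sub_le τ (d - σ.toHom k⁻¹ c') (σ.toHom k⁻¹ (c - c'))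
  rw [trace_star_mul_self, map_sub, sub_sub_sub_cancel_right] at h3
  linarith

end TraceAction

end Crossed

/-! ### The trace of the crossed product -/

/-- Tonelli's theorem for double series with non-negative terms. -/
theorem hasSum_swap {α β : Type*} {f : α → β → ℝ} (hf : ∀ a b, 0 ≤ f a b) {u : α → ℝ} {v : β → ℝ}
    {s : ℝ} (hu : ∀ a, HasSum (f a) (u a)) (hs : HasSum u s)
    (hv : ∀ b, HasSum (fun a => f a b) (v b)) :
    HasSum v s := by
  have hF : Summable fun p : α × β => f p.1 p.2 := by
    refine (summable_prod_of_nonneg fun p => hf p.1 p.2).2 ⟨fun a => (hu a).summable, ?_⟩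
    simpa only [(hu _).tsum_eq] using hs.summable
  have h1 : ∑' p : α × β, f p.1 p.2 = s := (hF.hasSum.prod_fiberwise hu).unique hs
  have h2 : HasSum (fun p : β × α => f p.2 p.1) s := by
    have := (Equiv.prodComm β α).hasSum_iff.2 (h1 ▸ hF.hasSum)
    exact this
  exact h2.prod_fiberwise hv

/-- Polarization: the hypothesis at `star x + y` and at `star x + i y` gives two linear relations,
whose sum isolates `φ (x * y)`. -/
theorem map_mul_comm_of_map_star_mul_self {A : Type*} [Ring A] [StarRing A] [Algebra ℂ A]
    [StarModule ℂ A] (φ : A →ₗ[ℂ] ℂ) (hφ : ∀ x, φ (star x * x) = φ (x * star x)) (x y : A) :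
    φ (x * y) = φ (y * x) := by
  have h0 := hφ (star x)
  have h1 := hφ y
  have h2 := hφ (star x + y)
  have h3 := hφ (star x + Complex.I • y)
  simp only [star_add, star_star, star_smul, mul_add, add_mul, map_add, smul_mul_assoc,
    mul_smul_comm, map_smul, smul_eq_mul, Complex.star_def, Complex.conj_I] at h0 h1 h2 h3
  have h4 : φ (x * y) + φ (star y * star x) = φ (star x * star y) + φ (y * x) := by
    linear_combination h2 - h0 - h1
  have h5 : φ (x * y) - φ (star y * star x) = -φ (star x * star y) + φ (y * x) := by
    refine mul_left_cancel₀ Complex.I_ne_zero ?_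
    linear_combination h3 - h0 + (Complex.I * Complex.I) * h1
  linear_combination (h4 + h5) / 2

section Crossed

variable {K : Type*} [NormedAddCommGroup K] [InnerProductSpace ℂ K] [CompleteSpace K]
variable {H : Type*} [Group H] {Q : VonNeumannAlgebra K} {τ : FaithfulNormalTrace Q}
variable (σ : TraceAction H τ)

namespace TraceAction

/-- The coefficient `x_g` of an element `x = ∑ x_g λ(g)` of the crossed product, up to `σ_g`: the
matrix entry of `x` at `(g, 1)`. -/
def coeff (x : σ.crossedProduct.toStarSubalgebra) (g : H) : Q.toStarSubalgebra :=
  ⟨entry (x : L2 H K →L[ℂ] L2 H K) g 1, σ.entry_mem x.2 g 1⟩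

theorem coe_coeff (x : σ.crossedProduct.toStarSubalgebra) (g : H) :
    (σ.coeff x g : K →L[ℂ] K) = entry (x : L2 H K →L[ℂ] L2 H K) g 1 := rfl

/-- Covariance moves column `h` to column `1`, so the coefficients carry the whole matrix. -/
theorem entry_eq_coeff (x : σ.crossedProduct.toStarSubalgebra) (g h : H) :
    entry (x : L2 H K →L[ℂ] L2 H K) g h = (σ.toHom h⁻¹ (σ.coeff x (g * h⁻¹)) : K →L[ℂ] K) := by
  obtain ⟨c, hc, hc'⟩ := σ.isCovariant x.2 (g * h⁻¹) 1 h
  rw [inv_mul_cancel_right, one_mul] at hc'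
  rw [hc']
  have : c = σ.coeff x (g * h⁻¹) := Subtype.ext hc.symm
  rw [this]

theorem coeff_star (x : σ.crossedProduct.toStarSubalgebra) (g : H) :
    σ.coeff (star x) g = star (σ.toHom g⁻¹ (σ.coeff x g⁻¹)) := by
  refine Subtype.ext ?_
  have h1 : (σ.coeff (star x) g : K →L[ℂ] K) = star (entry (x : L2 H K →L[ℂ] L2 H K) 1 g) :=
    entry_star _ _ _
  rw [h1, entry_eq_coeff, one_mul]
  rfl

theorem eq_zero_of_coeff_eq_zero {x : σ.crossedProduct.toStarSubalgebra}
    (hx : ∀ g, σ.coeff x g = 0) : x = 0 := by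
  refine Subtype.ext (ext_entry fun g h => ?_)
  rw [entry_eq_coeff, hx, map_zero]
  rfl

variable (τ) in
theorem hasSum_norm_sq_apply_emb {ξ : ℕ → K}
    (hξ : ∀ x : Q.toStarSubalgebra, HasSum (fun n => ⟪ξ n, (x : K →L[ℂ] K) (ξ n)⟫_ℂ) (τ.toLin x))
    (x : σ.crossedProduct.toStarSubalgebra) :
    HasSum (fun n => ((‖(x : L2 H K →L[ℂ] L2 H K) (emb 1 (ξ n))‖ ^ 2 : ℝ) : ℂ))
      (τ.toLin (σ.coeff (star x * x) 1)) := by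
  refine (hξ (σ.coeff (star x * x) 1)).congr_fun fun n => ?_
  rw [← inner_star_mul_self, inner_emb_apply]
  rfl

/-- Parseval's formula is stated for real parts; this recovers the complex value from it. -/
theorem trace_coeff_star_mul_self (x : σ.crossedProduct.toStarSubalgebra) :
    τ.toLin (σ.coeff (star x * x) 1) = ((τ.toLin (σ.coeff (star x * x) 1)).re : ℂ) := by
  obtain ⟨ξ, -, h, -⟩ := exists_vectors τ
  have h1 := σ.hasSum_norm_sq_apply_emb τ h x
  exact h1.unique (Complex.hasSum_ofReal.2 (Complex.hasSum_re h1))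

/-- Parseval's formula `‖x‖₂² = ∑ ‖x_g‖₂²`. -/
theorem hasSum_coeff (x : σ.crossedProduct.toStarSubalgebra) :
    HasSum (fun g => (τ.toLin (star (σ.coeff x g) * σ.coeff x g)).re)
      (τ.toLin (σ.coeff (star x * x) 1)).re := by
  obtain ⟨ξ, -, h, h'⟩ := exists_vectors τ
  refine hasSum_swap (f := fun n g => ‖(σ.coeff x g : K →L[ℂ] K) (ξ n)‖ ^ 2)
    (fun _ _ => by positivity)
    (fun n => hasSum_norm_sq ((x : L2 H K →L[ℂ] L2 H K) (emb 1 (ξ n)))) ?_ (fun g => h' _)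
  exact Complex.hasSum_re (σ.hasSum_norm_sq_apply_emb τ h x)

/-- The coefficient of `x*` at `g` has the same 2-norm as that of `x` at `g⁻¹`, so Parseval for `x`
and for `x*` gives the same sum, reindexed by inversion. -/
theorem trace_coeff_mul_star_self (x : σ.crossedProduct.toStarSubalgebra) :
    τ.toLin (σ.coeff (star x * x) 1) = τ.toLin (σ.coeff (x * star x) 1) := by
  have h1 := σ.hasSum_coeff (star x)
  rw [star_star] at h1
  have h2 : ∀ g, (τ.toLin (star (σ.coeff (star x) g) * σ.coeff (star x) g)).re =
      (τ.toLin (star (σ.coeff x g⁻¹) * σ.coeff x g⁻¹)).re := fun g => by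
    rw [coeff_star, sq_star τ.bounded, trace_star_mul_self]
  simp only [h2] at h1
  have h3 := h1.unique ((Equiv.inv H).hasSum_iff.2 (σ.hasSum_coeff x))
  rw [trace_coeff_star_mul_self, ← h3]
  have h4 := σ.trace_coeff_star_mul_self (star x)
  rw [star_star] at h4
  exact h4.symm

/-- The trace `x ↦ τ(x_1)` of the crossed product. -/
def crossedTrace : FaithfulNormalTrace σ.crossedProduct where
  toLin :=
    { toFun := fun x => τ.toLin (σ.coeff x 1)
      map_add' := fun x y => map_add τ.toLin (σ.coeff x 1) (σ.coeff y 1)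
      map_smul' := fun c x => map_smul τ.toLin c (σ.coeff x 1) }
  map_one := by
    change τ.toLin (σ.coeff 1 1) = 1
    rw [← τ.map_one]
    exact congrArg τ.toLin (Subtype.ext (entry_one_self 1))
  map_mul_comm := map_mul_comm_of_map_star_mul_self _ σ.trace_coeff_mul_star_self
  faithful x hx := by
    change τ.toLin (σ.coeff (star x * x) 1) = 0 at hx
    have h1 := σ.hasSum_coeff x
    rw [hx, Complex.zero_re, hasSum_zero_iff_of_nonneg fun g => τ.bounded.nonneg _] at h1
    refine σ.eq_zero_of_coeff_eq_zero fun g => τ.faithful _ ?_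
    rw [toLin_star_mul_self, congrFun h1 g]
    rfl
  normal := by
    obtain ⟨ξ, hs, h, -⟩ := exists_vectors τ
    refine ⟨fun n => emb 1 (ξ n), by simpa only [norm_emb] using hs, fun x => ?_⟩
    simp only [inner_emb_apply]
    exact h (σ.coeff x 1)

theorem crossedTrace_apply (x : σ.crossedProduct.toStarSubalgebra) :
    σ.crossedTrace.toLin x = τ.toLin (σ.coeff x 1) := rfl

end TraceAction

/-- The restriction of a trace to a von Neumann subalgebra. -/
def FaithfulNormalTrace.restrict {N M : VonNeumannAlgebra K} (τ : FaithfulNormalTrace M)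
    (h : N.toStarSubalgebra ≤ M.toStarSubalgebra) : FaithfulNormalTrace N where
  toLin := τ.toLin ∘ₗ (StarSubalgebra.inclusion h).toLinearMap
  map_one := τ.map_one
  map_mul_comm x y := τ.map_mul_comm (StarSubalgebra.inclusion h x) (StarSubalgebra.inclusion h y)
  faithful x hx := by
    have := τ.faithful (StarSubalgebra.inclusion h x) hx
    exact Subtype.ext (congrArg (fun z : M.toStarSubalgebra => (z : K →L[ℂ] K)) this)
  normal := by
    obtain ⟨ξ, hs, hξ⟩ := τ.normal
    exact ⟨ξ, hs, fun x => hξ (StarSubalgebra.inclusion h x)⟩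

/-! ### Infinite dimension and factoriality -/

/-- The translations move the vector `v` at position `1` to pairwise orthogonal non-zero vectors, so
they are linearly independent. -/
theorem not_finiteDimensional_of_leftTranslation_mem [Infinite H] [Nontrivial K]
    {R : VonNeumannAlgebra (L2 H K)} (hR : ∀ k : H, leftTranslation K k ∈ R) :
    ¬ FiniteDimensional ℂ R.toStarSubalgebra := by
  intro hfin
  obtain ⟨v, hv⟩ := exists_ne (0 : K)
  let ev : R.toStarSubalgebra →ₗ[ℂ] L2 H K :=
    { toFun := fun T => (T : L2 H K →L[ℂ] L2 H K) (emb 1 v)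
      map_add' := fun _ _ => rfl
      map_smul' := fun _ _ => rfl }
  have hli : LinearIndependent ℂ
      (ev ∘ fun k : H => (⟨leftTranslation K k, hR k⟩ : R.toStarSubalgebra)) := by
    have : (ev ∘ fun k : H => (⟨leftTranslation K k, hR k⟩ : R.toStarSubalgebra)) =
        fun k => emb k v := funext fun k => by
      change leftTranslation K k (emb 1 v) = _
      rw [leftTranslation_emb, mul_one]
    rw [this]
    refine linearIndependent_of_ne_zero_of_inner_eq_zero (fun k hk => hv ?_) fun g h hgh => ?_
    · rw [← norm_eq_zero, ← norm_emb k v, hk, norm_zero]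
    · change ⟪emb g v, emb h v⟫_ℂ = 0
      rw [inner_emb_left, emb_apply_ne hgh, inner_zero_right]
  have := (LinearIndependent.of_comp ev hli).finite
  exact not_finite H

theorem IsIIOneFactor.nontrivial {Q : VonNeumannAlgebra K} (hQ : IsIIOneFactor Q) :
    Nontrivial K := by
  by_contra h
  rw [not_nontrivial_iff_subsingleton] at h
  have : Subsingleton Q.toStarSubalgebra :=
    ⟨fun x y => Subtype.ext (ContinuousLinearMap.ext fun v => Subsingleton.elim _ _)⟩
  exact hQ.infinite inferInstance

theorem IsICC.infinite [Nontrivial H] (h : IsICC H) : Infinite H := by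
  obtain ⟨g, hg⟩ := exists_ne (1 : H)
  exact Set.infinite_univ_iff.1 ((h g hg).mono (Set.subset_univ _))

/-! ### The relative commutant of `L(H)` -/

namespace TraceAction

variable {σ}

/-- The trivial group is vacuously icc, so it has to be excluded: for it ergodicity would force `Q =
ℂ`. -/
theorem IsErgodic.nontrivial (herg : σ.IsErgodic) (hQ : IsIIOneFactor Q) : Nontrivial H := by
  by_contra h
  rw [not_nontrivial_iff_subsingleton] at h
  refine hQ.infinite (Module.Finite.of_surjective (Algebra.linearMap ℂ Q.toStarSubalgebra) ?_)
  intro x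
  obtain ⟨c, hc⟩ := herg x fun g => by
    rw [Subsingleton.elim g 1, toHom_one_apply]
  exact ⟨c, hc.symm⟩

/-- The relative commutant of `L(H)` in the crossed product is trivial. -/
theorem IsErgodic.eq_smul_one (herg : σ.IsErgodic) (hicc : IsICC H) {x : L2 H K →L[ℂ] L2 H K}
    (hx : x ∈ σ.crossedProduct) (hc : x ∈ (groupVN H K).commutant) :
    ∃ c : ℂ, x = c • (1 : L2 H K →L[ℂ] L2 H K) := by
  let X : σ.crossedProduct.toStarSubalgebra := ⟨x, hx⟩
  have hconj : ∀ k h, σ.coeff X h = σ.toHom k⁻¹ (σ.coeff X (k * h * k⁻¹)) := by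
    intro k h
    refine Subtype.ext ?_
    have h1 : Commute (leftTranslation K k) x :=
      VonNeumannAlgebra.mem_commutant_iff.1 hc _ (leftTranslation_mem_groupVN k)
    rw [← entry_eq_coeff, coe_coeff, ← commute_leftTranslation_iff.1 h1 h 1, mul_one]
  have hzero : ∀ h ≠ 1, σ.coeff X h = 0 := by
    intro h hh
    refine τ.faithful _ ?_
    rw [toLin_star_mul_self]
    by_contra hne
    have hpos : 0 < (τ.toLin (star (σ.coeff X h) * σ.coeff X h)).re :=
      lt_of_le_of_ne (τ.bounded.nonneg _) fun h0 => hne (by rw [← h0, Complex.ofReal_zero])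
    -- Summability leaves only finitely many `g` whose coefficient has squared 2-norm at least that
    -- at `h`, yet the whole conjugacy class of `h` qualifies.
    have hfin := (σ.hasSum_coeff X).summable.tendsto_cofinite_zero.eventually (gt_mem_nhds hpos)
    refine hicc h hh ((Filter.eventually_cofinite.1 hfin).subset fun g hg => ?_)
    obtain ⟨k, rfl⟩ := isConj_iff.1 (show IsConj h g from hg)
    change ¬ _ < _
    rw [hconj k h, trace_star_mul_self]
    exact lt_irrefl _
  obtain ⟨c, hc⟩ := herg (σ.coeff X 1) fun g => by
    have := hconj g⁻¹ 1
    rw [inv_inv, mul_one, inv_mul_cancel] at this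
    exact this.symm
  refine ⟨c, ?_⟩
  have h1 : X - algebraMap ℂ _ c = 0 := by
    refine σ.eq_zero_of_coeff_eq_zero fun g => Subtype.ext ?_
    have h2 : (σ.coeff (X - algebraMap ℂ _ c) g : K →L[ℂ] K) =
        σ.coeff X g - c • entry (1 : L2 H K →L[ℂ] L2 H K) g 1 := rfl
    rw [h2]
    obtain rfl | hg := eq_or_ne g 1
    · rw [hc, entry_one_self]
      exact sub_self _
    · rw [hzero g hg, entry_one_ne hg, smul_zero]
      exact sub_zero _
  exact congrArg Subtype.val (sub_eq_zero.1 h1)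

/-- The centre of `L(H)`, the centre of the crossed product and the relative commutant all lie in
`N' ∩ M`, which is `ℂ`. -/
theorem IsErgodic.isIrreducibleSubfactor (herg : σ.IsErgodic) (hicc : IsICC H)
    (hQ : IsIIOneFactor Q) : IsIrreducibleSubfactor (groupVN H K) σ.crossedProduct := by
  have := hQ.nontrivial
  have := herg.nontrivial hQ
  have := hicc.infinite
  refine ⟨fun x => σ.groupVN_le, ⟨?_, ?_, ?_⟩, ⟨?_, ?_, ?_⟩, ?_⟩
  · exact fun x hx hc => herg.eq_smul_one hicc (σ.groupVN_le hx) hc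
  · exact not_finiteDimensional_of_leftTranslation_mem leftTranslation_mem_groupVN
  · exact ⟨σ.crossedTrace.restrict fun x => σ.groupVN_le⟩
  · refine fun x hx hc => herg.eq_smul_one hicc hx ?_
    rw [VonNeumannAlgebra.mem_commutant_iff] at hc ⊢
    exact fun g hg => hc g (σ.groupVN_le hg)
  · exact not_finiteDimensional_of_leftTranslation_mem σ.leftTranslation_mem
  · exact ⟨σ.crossedTrace⟩
  · intro x hx hc
    obtain ⟨c, rfl⟩ := herg.eq_smul_one hicc hx hc
    exact (groupVN H K).toStarSubalgebra.smul_mem (one_mem _) c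

end TraceAction

end Crossed

/-! ### Slice maps and the conditional expectation onto `L(H)` -/

section Slice

universe u

variable {K : Type u} [NormedAddCommGroup K] [InnerProductSpace ℂ K]

/-- The column `ζ ↦ ((1 ⊗ T j) ζ)_j` on `ℓ²(H, K)` of a family with `∑ (T j)* (T j) = 1`. -/
def sliceColumn (H : Type*) {J : Type*} (T : J → K →L[ℂ] K)
    (hT : ∀ v, HasSum (fun j => ‖T j v‖ ^ 2) (‖v‖ ^ 2)) : L2 H K →L[ℂ] L2 J (L2 H K) :=
  have h : ∀ ζ : L2 H K, HasSum (fun j => ‖ampl H (T j) ζ‖ ^ 2) (‖ζ‖ ^ 2) := fun ζ =>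
    hasSum_swap (f := fun g j => ‖T j (ζ g)‖ ^ 2) (fun _ _ => by positivity) (fun g => hT (ζ g))
      (hasSum_norm_sq ζ) (fun j => hasSum_norm_sq (ampl H (T j) ζ))
  columnOp (fun j => ampl H (T j)) 1 zero_le_one (fun ζ => (h ζ).summable)
    (fun ζ => by rw [(h ζ).tsum_eq, one_pow, one_mul])

variable {H : Type*} {J : Type*} {T : J → K →L[ℂ] K}
  (hT : ∀ v, HasSum (fun j => ‖T j v‖ ^ 2) (‖v‖ ^ 2))

theorem sliceColumn_apply (ζ : L2 H K) (j : J) : sliceColumn H T hT ζ j = ampl H (T j) ζ := rfl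

theorem norm_sliceColumn_apply (ζ : L2 H K) : ‖sliceColumn H T hT ζ‖ = ‖ζ‖ := by
  have h : HasSum (fun j => ‖ampl H (T j) ζ‖ ^ 2) (‖ζ‖ ^ 2) :=
    hasSum_swap (f := fun g j => ‖T j (ζ g)‖ ^ 2) (fun _ _ => by positivity) (fun g => hT (ζ g))
      (hasSum_norm_sq ζ) (fun j => hasSum_norm_sq (ampl H (T j) ζ))
  exact (sq_eq_sq₀ (norm_nonneg _) (norm_nonneg _)).1
    ((hasSum_norm_sq (sliceColumn H T hT ζ)).unique h)

/-- Operators that commute with `1 ⊗ B(K)` pass through the column. This makes the slice map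
bimodular over them and, the column being an isometry, the identity on them. -/
theorem ampl_comp_sliceColumn {z : L2 H K →L[ℂ] L2 H K}
    (hz : ∀ t : K →L[ℂ] K, Commute z (ampl H t)) :
    ampl J z ∘L sliceColumn H T hT = sliceColumn H T hT ∘L z :=
  ContinuousLinearMap.ext fun ζ => lp.ext (funext fun j =>
    congrArg (fun S => S ζ) (hz (T j)).eq)

variable [CompleteSpace K]

/-- The map `x ↦ ∑ (1 ⊗ T j)* x (1 ⊗ T j)`. -/
def sliceMap (x : L2 H K →L[ℂ] L2 H K) : L2 H K →L[ℂ] L2 H K :=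
  ContinuousLinearMap.adjoint (sliceColumn H T hT) ∘L ampl J x ∘L sliceColumn H T hT

/-- The slice map works entry by entry: each entry `a` becomes the weak sum `∑ (T j)* a (T j)`. -/
theorem hasSum_inner_entry_sliceMap (x : L2 H K →L[ℂ] L2 H K) (g h : H) (v w : K) :
    HasSum (fun j => ⟪T j v, entry x g h (T j w)⟫_ℂ) ⟪v, entry (sliceMap hT x) g h w⟫_ℂ := by
  rw [entry_apply, ← inner_emb_left, sliceMap, ContinuousLinearMap.comp_apply,
    ContinuousLinearMap.adjoint_inner_right]
  refine (lp.hasSum_inner (𝕜 := ℂ) (G := fun _ : J => L2 H K) _ _).congr_fun fun j => ?_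
  rw [ContinuousLinearMap.comp_apply, ampl_apply, sliceColumn_apply, sliceColumn_apply, ampl_emb,
    ampl_emb, inner_emb_left]
  rfl

theorem adjoint_comp_sliceColumn :
    ContinuousLinearMap.adjoint (sliceColumn H T hT) ∘L sliceColumn H T hT = 1 :=
  (ContinuousLinearMap.norm_map_iff_adjoint_comp_self _).1 (norm_sliceColumn_apply hT)

theorem adjoint_sliceColumn_comp_ampl {z : L2 H K →L[ℂ] L2 H K}
    (hz : ∀ t : K →L[ℂ] K, Commute z (ampl H t)) :
    ContinuousLinearMap.adjoint (sliceColumn H T hT) ∘L ampl J z =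
      z ∘L ContinuousLinearMap.adjoint (sliceColumn H T hT) := by
  have h1 : ∀ t : K →L[ℂ] K, Commute (star z) (ampl H t) := fun t => by
    have := (hz (star t)).star_star
    rwa [star_ampl, star_star] at this
  have h2 := congrArg ContinuousLinearMap.adjoint (ampl_comp_sliceColumn hT h1)
  rwa [ContinuousLinearMap.adjoint_comp, ContinuousLinearMap.adjoint_comp, ← star_ampl,
    ContinuousLinearMap.star_eq_adjoint, ContinuousLinearMap.star_eq_adjoint,
    ContinuousLinearMap.adjoint_adjoint, ContinuousLinearMap.adjoint_adjoint] at h2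

theorem sliceMap_bimodule (x : L2 H K →L[ℂ] L2 H K) {y z : L2 H K →L[ℂ] L2 H K}
    (hy : ∀ t : K →L[ℂ] K, Commute y (ampl H t)) (hz : ∀ t : K →L[ℂ] K, Commute z (ampl H t)) :
    sliceMap hT (y * x * z) = y * sliceMap hT x * z := by
  have h1 : sliceMap hT (y * x * z) =
      (ContinuousLinearMap.adjoint (sliceColumn H T hT) ∘L ampl J y) ∘L ampl J x ∘L
        (ampl J z ∘L sliceColumn H T hT) := rfl
  rw [h1, adjoint_sliceColumn_comp_ampl hT hy, ampl_comp_sliceColumn hT hz]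
  rfl

theorem sliceMap_of_commute {y : L2 H K →L[ℂ] L2 H K}
    (hy : ∀ t : K →L[ℂ] K, Commute y (ampl H t)) : sliceMap hT y = y := by
  rw [sliceMap, ampl_comp_sliceColumn hT hy, ← ContinuousLinearMap.comp_assoc,
    adjoint_comp_sliceColumn]
  rfl

theorem isPositive_sliceMap (x : L2 H K →L[ℂ] L2 H K) : (sliceMap hT (star x * x)).IsPositive := by
  have h1 : sliceMap hT (star x * x) =
      ContinuousLinearMap.adjoint (ampl J x ∘L sliceColumn H T hT) ∘L
        (ampl J x ∘L sliceColumn H T hT) := by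
    rw [sliceMap, ampl_mul, ← star_ampl, ContinuousLinearMap.adjoint_comp]
    rfl
  rw [h1]
  exact ContinuousLinearMap.isPositive_adjoint_comp_self _

/-- With vectors `ξ n` implementing `τ` and a Hilbert basis `b`, the rank-one operators `v ↦ ⟪b i,
v⟫ ξ n` satisfy `∑ T* x T = τ(x) 1`; the case `x = 1` is the normalisation that makes the column
isometric. -/
theorem exists_slice_family {Q : VonNeumannAlgebra K} (τ : FaithfulNormalTrace Q) :
    ∃ (J : Type u) (T : J → K →L[ℂ] K), (∀ v, HasSum (fun j => ‖T j v‖ ^ 2) (‖v‖ ^ 2)) ∧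
      ∀ (x : Q.toStarSubalgebra) (v w : K),
        HasSum (fun j => ⟪T j v, (x : K →L[ℂ] K) (T j w)⟫_ℂ) (τ.toLin x * ⟪v, w⟫_ℂ) := by
  obtain ⟨ξ, -, h, -⟩ := exists_vectors τ
  obtain ⟨B, b, -⟩ := exists_hilbertBasis ℂ K
  let T : ℕ × B → K →L[ℂ] K := fun p => InnerProductSpace.rankOne ℂ (ξ p.1) (b p.2)
  have key : ∀ (x : Q.toStarSubalgebra) (v w : K),
      HasSum (fun p => ⟪T p v, (x : K →L[ℂ] K) (T p w)⟫_ℂ) (τ.toLin x * ⟪v, w⟫_ℂ) := by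
    intro x v w
    let f : ℕ → ℂ := fun n => ⟪ξ n, (x : K →L[ℂ] K) (ξ n)⟫_ℂ
    let g : B → ℂ := fun i => ⟪v, b i⟫_ℂ * ⟪b i, w⟫_ℂ
    have h1 : HasSum f (τ.toLin x) := h x
    have h2 : HasSum g ⟪v, w⟫_ℂ := b.hasSum_inner_mul_inner v w
    have h3 : Summable fun p : ℕ × B => f p.1 * g p.2 :=
      summable_mul_of_summable_norm h1.summable.norm h2.summable.norm
    refine (h1.mul h2 h3).congr_fun fun p => ?_
    change _ = ⟪ξ p.1, (x : K →L[ℂ] K) (ξ p.1)⟫_ℂ * (⟪v, b p.2⟫_ℂ * ⟪b p.2, w⟫_ℂ)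
    rw [InnerProductSpace.rankOne_apply, InnerProductSpace.rankOne_apply, map_smul,
      inner_smul_left, inner_smul_right, inner_conj_symm]
    ring
  refine ⟨ℕ × B, T, fun v => ?_, key⟩
  have h3 := Complex.hasSum_re (key 1 v v)
  rw [τ.map_one, one_mul] at h3
  have h4 : (⟪v, v⟫_ℂ).re = ‖v‖ ^ 2 := inner_self_eq_norm_sq (𝕜 := ℂ) v
  rw [h4] at h3
  exact h3.congr_fun fun p => (inner_self_eq_norm_sq (𝕜 := ℂ) (T p v)).symm

end Slice

/-! ### The conditional expectation onto `L(H)` -/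

namespace TraceAction

variable {K : Type*} [NormedAddCommGroup K] [InnerProductSpace ℂ K] [CompleteSpace K]
variable {H : Type*} [Group H] {Q : VonNeumannAlgebra K} {τ : FaithfulNormalTrace Q}
variable (σ : TraceAction H τ)

/-- Operators with scalar matrix entries that are constant along `g h⁻¹` belong to `L(H)`. -/
theorem mem_groupVN_of_entry {S : L2 H K →L[ℂ] L2 H K} {c : H → ℂ}
    (hS : ∀ g h, entry S g h = c (g * h⁻¹) • (1 : K →L[ℂ] K)) : S ∈ groupVN H K := by
  refine mem_groupVN_iff.2 fun t ht => ext_entry fun g h => ContinuousLinearMap.ext fun v => ?_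
  have h1 := hasSum_entry_mul S t g h v
  have h2 := hasSum_entry_mul t S g h v
  -- The substitution `k ↦ g k⁻¹ h` matches the two products term by term: the scalar is `c (g k⁻¹)`
  -- in both, and translation by `g k⁻¹` carries the entry of `t` at `(k, h)` to the one at `(g, g
  -- k⁻¹ h)`.
  let e : H ≃ H := (Equiv.inv H).trans ((Equiv.mulLeft g).trans (Equiv.mulRight h))
  refine h1.unique ((e.hasSum_iff.2 h2).congr_fun fun k => ?_)
  have h3 : e k = g * k⁻¹ * h := rfl
  have h4 := commute_leftTranslation_iff.1 (ht (g * k⁻¹)) k h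
  rw [inv_mul_cancel_right] at h4
  rw [hS, Function.comp_apply, hS, h3, h4, mul_inv_cancel_right, smul_apply,
    smul_apply, map_smul]
  rfl

/-- The trace-preserving conditional expectation of `Q ⋊ H` onto `L(H)`, together with its formula
`E (x) = ∑ τ(x_g) λ(g)` in terms of matrix entries. -/
theorem exists_condExp : ∃ E : σ.crossedProduct.toStarSubalgebra →ₗ[ℂ]
    σ.crossedProduct.toStarSubalgebra, IsCondExp (groupVN H K) σ.crossedTrace E ∧
      ∀ x g h, entry (E x : L2 H K →L[ℂ] L2 H K) g h =
        τ.toLin (σ.coeff x (g * h⁻¹)) • (1 : K →L[ℂ] K) := by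
  obtain ⟨J, T, hT, hτ⟩ := exists_slice_family τ
  have hentry : ∀ (x : σ.crossedProduct.toStarSubalgebra) (g h : H),
      entry (sliceMap hT (x : L2 H K →L[ℂ] L2 H K)) g h =
        τ.toLin (σ.coeff x (g * h⁻¹)) • (1 : K →L[ℂ] K) := by
    intro x g h
    refine ContinuousLinearMap.ext fun w => ext_inner_left ℂ fun v => ?_
    have h1 := hasSum_inner_entry_sliceMap hT (x : L2 H K →L[ℂ] L2 H K) g h v w
    rw [entry_eq_coeff] at h1
    -- Invariance of `τ` removes the twist `σ_h⁻¹`, so the sliced entry depends on `g h⁻¹` alone.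
    rw [h1.unique (hτ _ v w), σ.trace_map, smul_apply, inner_smul_right]
    rfl
  have hmem : ∀ x : σ.crossedProduct.toStarSubalgebra,
      sliceMap hT (x : L2 H K →L[ℂ] L2 H K) ∈ groupVN H K :=
    fun x => mem_groupVN_of_entry (c := fun g => τ.toLin (σ.coeff x g)) (hentry x)
  refine ⟨
    { toFun := fun x => ⟨sliceMap hT x, σ.groupVN_le (hmem x)⟩
      map_add' := fun x y => Subtype.ext (by
        change sliceMap hT ((x : L2 H K →L[ℂ] L2 H K) + (y : L2 H K →L[ℂ] L2 H K)) =
          sliceMap hT (x : L2 H K →L[ℂ] L2 H K) + sliceMap hT (y : L2 H K →L[ℂ] L2 H K)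
        rw [sliceMap, ampl_add, ContinuousLinearMap.add_comp, ContinuousLinearMap.comp_add]
        rfl)
      map_smul' := fun c x => Subtype.ext (by
        change sliceMap hT (c • (x : L2 H K →L[ℂ] L2 H K)) =
          c • sliceMap hT (x : L2 H K →L[ℂ] L2 H K)
        rw [sliceMap, ampl_smul, ContinuousLinearMap.smul_comp, ContinuousLinearMap.comp_smul]
        rfl) }, ⟨?_, ?_, ?_, ?_, ?_⟩, hentry⟩
  · exact hmem
  · exact fun y hy => Subtype.ext (sliceMap_of_commute hT (commute_ampl_of_mem_groupVN hy))
  · exact fun x y z hy hz => Subtype.ext (sliceMap_bimodule hT _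
      (commute_ampl_of_mem_groupVN hy) (commute_ampl_of_mem_groupVN hz))
  · exact fun x => isPositive_sliceMap hT (x : L2 H K →L[ℂ] L2 H K)
  · intro x
    rw [crossedTrace_apply, crossedTrace_apply]
    have h1 : ∀ z : Q.toStarSubalgebra, (z : K →L[ℂ] K) = τ.toLin (σ.coeff x 1) • 1 →
        τ.toLin z = τ.toLin (σ.coeff x 1) := by
      intro z hz
      have : z = τ.toLin (σ.coeff x 1) • 1 := Subtype.ext hz
      rw [this, map_smul, τ.map_one, smul_eq_mul, mul_one]
    refine h1 _ ?_
    have := hentry x 1 1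
    rw [inv_one, mul_one] at this
    exact this

end TraceAction

/-! ### Asymptotically central sequences -/

theorem add_mul_sub_mul_add {R : Type*} [Ring R] (a b z : R) :
    (a + b) * z - z * (a + b) = (a * z - z * a) + (b * z - z * b) := by
  noncomm_ring

section TwoNorm

variable {K : Type*} [NormedAddCommGroup K] [InnerProductSpace ℂ K] [CompleteSpace K]
variable {M : VonNeumannAlgebra K} (τ : FaithfulNormalTrace M)

theorem twoNorm_smul (c : ℂ) (x : M.toStarSubalgebra) :
    twoNorm τ.toLin (c • x) = ‖c‖ * twoNorm τ.toLin x := by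
  have h : τ.toLin (star (c • x) * (c • x)) = ((‖c‖ ^ 2 : ℝ) : ℂ) * τ.toLin (star x * x) := by
    rw [star_smul, smul_mul_smul_comm, map_smul, smul_eq_mul, Complex.star_def, Complex.conj_mul']
    norm_cast
  rw [twoNorm, h, Complex.re_ofReal_mul, Real.sqrt_mul (by positivity),
    Real.sqrt_sq (norm_nonneg c)]
  rfl

theorem twoNorm_one : twoNorm τ.toLin 1 = 1 := by
  rw [twoNorm, star_one, one_mul, τ.map_one, Complex.one_re, Real.sqrt_one]

theorem tendsto_twoNorm_add {ι : Type*} {l : Filter ι} {f g : ι → M.toStarSubalgebra}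
    (hf : Tendsto (fun n => twoNorm τ.toLin (f n)) l (𝓝 0))
    (hg : Tendsto (fun n => twoNorm τ.toLin (g n)) l (𝓝 0)) :
    Tendsto (fun n => twoNorm τ.toLin (f n + g n)) l (𝓝 0) := by
  rw [tendsto_twoNorm_iff τ.bounded] at hf hg ⊢
  have h := (hf.const_mul 2).add (hg.const_mul 2)
  rw [mul_zero, add_zero] at h
  exact squeeze_zero (fun n => τ.bounded.nonneg _) (fun n => sq_add_le τ.bounded (f n) (g n)) h

/-- The elements that commute asymptotically with the sequence `z` in the 2-norm. -/
def asymptoticCommutant (z : ℕ → M.toStarSubalgebra) : Submodule ℂ M.toStarSubalgebra where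
  carrier := {y | Tendsto (fun n => twoNorm τ.toLin (y * z n - z n * y)) atTop (𝓝 0)}
  add_mem' {a b} ha hb := (tendsto_twoNorm_add τ ha hb).congr fun n => by
    rw [add_mul_sub_mul_add]
  zero_mem' := by simp [twoNorm]
  smul_mem' c a ha := by
    have h : Tendsto (fun n => ‖c‖ * twoNorm τ.toLin (a * z n - z n * a)) atTop (𝓝 (‖c‖ * 0)) :=
      ha.const_mul ‖c‖
    rw [mul_zero] at h
    refine h.congr fun n => ?_
    rw [← twoNorm_smul, smul_sub, smul_mul_assoc, mul_smul_comm]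

theorem mem_asymptoticCommutant {z : ℕ → M.toStarSubalgebra} {y : M.toStarSubalgebra} :
    y ∈ asymptoticCommutant τ z ↔
      Tendsto (fun n => twoNorm τ.toLin (y * z n - z n * y)) atTop (𝓝 0) := Iff.rfl

theorem exists_norm_toLin_le : ∃ D, 0 ≤ D ∧ ∀ x : M.toStarSubalgebra, ‖τ.toLin x‖ ≤ ‖x‖ * D := by
  obtain ⟨ξ, hs, h, -⟩ := exists_vectors τ
  refine ⟨∑' n, ‖ξ n‖ ^ 2, tsum_nonneg fun n => by positivity, fun x => ?_⟩
  rw [← (h x).tsum_eq]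
  refine tsum_of_norm_bounded (hs.hasSum.mul_left ‖x‖) fun n => ?_
  calc ‖⟪ξ n, (x : K →L[ℂ] K) (ξ n)⟫_ℂ‖ ≤ ‖ξ n‖ * ‖(x : K →L[ℂ] K) (ξ n)‖ := norm_inner_le_norm _ _
    _ ≤ ‖ξ n‖ * (‖x‖ * ‖ξ n‖) :=
      mul_le_mul_of_nonneg_left ((x : K →L[ℂ] K).le_opNorm _) (norm_nonneg _)
    _ = ‖x‖ * ‖ξ n‖ ^ 2 := by ring

/-- Asymptotic commutation with a bounded sequence passes to limits in the 2-norm. -/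
theorem mem_asymptoticCommutant_of_approx {z : ℕ → M.toStarSubalgebra} {C : ℝ} (hz : ∀ n, ‖z n‖ ≤ C)
    {y : M.toStarSubalgebra}
    (h : ∀ ε > 0, ∃ a ∈ asymptoticCommutant τ z, (τ.toLin (star (y - a) * (y - a))).re ≤ ε) :
    y ∈ asymptoticCommutant τ z := by
  rw [mem_asymptoticCommutant, tendsto_twoNorm_iff τ.bounded, Metric.tendsto_atTop]
  intro ε hε
  -- Each of the two products with `y - a` contributes at most `ε / 16`. After the doublings in `h4`
  -- and `h3` they give `ε / 2` in total, and the commutator with `a` gives less than `ε / 2`. The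
  -- `+ 1` keeps the denominator positive.
  obtain ⟨a, hlim, ha⟩ := h (ε / (16 * (C ^ 2 + 1))) (by positivity)
  rw [mem_asymptoticCommutant, tendsto_twoNorm_iff τ.bounded, Metric.tendsto_atTop] at hlim
  obtain ⟨N, hN⟩ := hlim (ε / 4) (by positivity)
  refine ⟨N, fun n hn => ?_⟩
  have h1 := hN n hn
  rw [Real.dist_0_eq_abs, abs_of_nonneg (τ.bounded.nonneg _)] at h1 ⊢
  have h2 : y * z n - z n * y = (a * z n - z n * a) + ((y - a) * z n - z n * (y - a)) := by
    rw [← add_mul_sub_mul_add, add_sub_cancel]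
  rw [h2]
  have h3 := sq_add_le τ.bounded (a * z n - z n * a) ((y - a) * z n - z n * (y - a))
  have h4 := sq_sub_le τ ((y - a) * z n) (z n * (y - a))
  have h5 := sq_mul_le' τ.bounded (z n) (y - a)
  have h6 := τ.bounded.mul_le (z n) (y - a)
  have h7 : ‖z n‖ ^ 2 * (τ.toLin (star (y - a) * (y - a))).re ≤
      (C ^ 2 + 1) * (ε / (16 * (C ^ 2 + 1))) :=
    mul_le_mul ((pow_le_pow_left₀ (norm_nonneg _) (hz n) 2).trans (by linarith)) ha
      (τ.bounded.nonneg _) (by positivity)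
  have h8 : (C ^ 2 + 1) * (ε / (16 * (C ^ 2 + 1))) = ε / 16 := by
    field_simp
  linarith

end TwoNorm

/-! ### From the ultraproduct to central sequences -/

namespace TraceAction

variable {K : Type*} [NormedAddCommGroup K] [InnerProductSpace ℂ K] [CompleteSpace K]
variable {H : Type*} [Group H] {Q : VonNeumannAlgebra K} {τ : FaithfulNormalTrace Q}
variable {σ : TraceAction H τ}

variable (τ) in
theorem one_ne_zero_ultraproduct (ω : Ultrafilter ℕ) : (1 : Ultraproduct τ.bounded ω) ≠ 0 := by
  intro h
  rw [← map_one (ultraMk τ.bounded ω), ← map_zero (ultraMk τ.bounded ω), ultraMk_eq_iff] at h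
  have h' : Tendsto (fun _ : ℕ => (1 : ℝ)) ω (𝓝 0) := h.congr fun n => by
    change twoNorm τ.toLin (1 - 0) = 1
    rw [sub_zero, twoNorm_one]
  exact one_ne_zero (tendsto_nhds_unique tendsto_const_nhds h')

variable (τ) in
theorem trace_sub_trace_smul_one (a : Q.toStarSubalgebra) :
    τ.toLin (a - τ.toLin a • (1 : Q.toStarSubalgebra)) = 0 := by
  rw [map_sub τ.toLin, map_smul τ.toLin, τ.map_one, smul_eq_mul, mul_one, sub_self]

theorem toHom_sub_smul_one_sub (h : H) (a : Q.toStarSubalgebra) (c : ℂ) :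
    σ.toHom h (a - c • (1 : Q.toStarSubalgebra)) - (a - c • (1 : Q.toStarSubalgebra)) =
      σ.toHom h a - a := by
  rw [map_sub (σ.toHom h), map_smul (σ.toHom h), map_one (σ.toHom h), sub_sub_sub_cancel_right]

variable (τ) in
/-- The bounded sequence `(a n)` and its scalar part `(τ (a n))` have different classes in `Q^ω`,
unless the class of `(a n)` is a scalar. -/
theorem exists_algebraMap_of_tendsto {ω : Ultrafilter ℕ} (a : boundedSeq Q.toStarSubalgebra) {B : ℝ}
    (hB : ∀ n, ‖τ.toLin ((a : ℕ → Q.toStarSubalgebra) n)‖ ≤ B)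
    (ha : Tendsto (fun n => twoNorm τ.toLin ((a : ℕ → Q.toStarSubalgebra) n -
      τ.toLin ((a : ℕ → Q.toStarSubalgebra) n) • (1 : Q.toStarSubalgebra))) ω (𝓝 0)) :
    ∃ l : ℂ, ultraMk τ.bounded ω a = algebraMap ℂ _ l := by
  -- A bounded scalar sequence converges along an ultrafilter; its limit is the required scalar.
  obtain ⟨l, -, hl⟩ := (isCompact_closedBall (0 : ℂ) B).ultrafilter_le_nhds
    (ω.map fun n => τ.toLin ((a : ℕ → Q.toStarSubalgebra) n))
    (by
      rw [le_principal_iff]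
      exact Filter.mem_map.2 (Filter.univ_mem' fun n => mem_closedBall_zero_iff.2 (hB n)))
  have hl' : Tendsto (fun n => τ.toLin ((a : ℕ → Q.toStarSubalgebra) n)) ω (𝓝 l) := hl
  refine ⟨l, ?_⟩
  have hc : Tendsto (fun n => twoNorm τ.toLin
      ((τ.toLin ((a : ℕ → Q.toStarSubalgebra) n) - l) • (1 : Q.toStarSubalgebra))) ω (𝓝 0) := by
    simp only [twoNorm_smul, twoNorm_one, mul_one]
    exact tendsto_iff_norm_sub_tendsto_zero.1 hl'
  rw [← AlgHom.commutes (ultraMk τ.bounded ω), ultraMk_eq_iff]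
  refine (tendsto_twoNorm_add τ ha hc).congr fun n => ?_
  rw [sub_smul, sub_add_sub_cancel, ← Algebra.algebraMap_eq_smul_one]
  rfl

/-- Diffuseness is applied only below the projection `1`. -/
theorem exists_nontrivial_projection {ω : Ultrafilter ℕ} (hdiff : IsDiffuse (σ.ultraFixed ω)) :
    ∃ q : Ultraproduct τ.bounded ω, q ∈ σ.ultraFixed ω ∧ q * q = q ∧ q ≠ 0 ∧ q ≠ 1 := by
  obtain ⟨q, hq, -, hq0, hq1⟩ := hdiff 1 (.one _) fun h =>
    one_ne_zero_ultraproduct τ ω (congrArg Subtype.val h)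
  exact ⟨q, q.2, congrArg Subtype.val hq.isIdempotentElem, fun h => hq0 (Subtype.ext h),
    fun h => hq1 (Subtype.ext h)⟩

theorem tendsto_of_mem_ultraFixed {ω : Ultrafilter ℕ} {a : boundedSeq Q.toStarSubalgebra}
    (ha : ultraMk τ.bounded ω a ∈ σ.ultraFixed ω) (h : H) :
    Tendsto (fun n => twoNorm τ.toLin (σ.toHom h ((a : ℕ → Q.toStarSubalgebra) n) -
      (a : ℕ → Q.toStarSubalgebra) n)) ω (𝓝 0) := by
  have h1 : ultraMk τ.bounded ω (seqMap (σ.toHom h) (norm_aut_le _) a) = ultraMk τ.bounded ω a :=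
    ha h
  rw [ultraMk_eq_iff] at h1
  exact h1

/-- A projection of `(Q^ω)^σ` other than `0` and `1` gives a bounded, asymptotically invariant
sequence of trace zero elements of `Q` whose 2-norms stay away from zero. -/
theorem exists_asymptotically_fixed {ω : Ultrafilter ℕ} (hdiff : IsDiffuse (σ.ultraFixed ω)) :
    ∃ (y : ℕ → Q.toStarSubalgebra) (C δ : ℝ), (∀ n, ‖y n‖ ≤ C) ∧ (∀ n, τ.toLin (y n) = 0) ∧
      0 < δ ∧ (∀ᶠ n in ω, δ ≤ twoNorm τ.toLin (y n)) ∧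
      ∀ h, Tendsto (fun n => twoNorm τ.toLin (σ.toHom h (y n) - y n)) ω (𝓝 0) := by
  obtain ⟨q, hq, hqq, hq0, hq1⟩ := exists_nontrivial_projection hdiff
  obtain ⟨a, rfl⟩ := ultraMk_surjective τ.bounded ω q
  obtain ⟨C, hC⟩ := a.2
  obtain ⟨D, hD0, hD⟩ := exists_norm_toLin_le τ
  have hτ : ∀ n, ‖τ.toLin ((a : ℕ → Q.toStarSubalgebra) n)‖ ≤ C * D := fun n =>
    (hD _).trans (mul_le_mul_of_nonneg_right (hC n) hD0)
  -- Otherwise the class of `a` would be a scalar `l` with `l² = l`, hence `0` or `1`.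
  have hnot : ¬ Tendsto (fun n => twoNorm τ.toLin ((a : ℕ → Q.toStarSubalgebra) n -
      τ.toLin ((a : ℕ → Q.toStarSubalgebra) n) • (1 : Q.toStarSubalgebra))) ω (𝓝 0) := by
    intro hy
    obtain ⟨l, hl⟩ := exists_algebraMap_of_tendsto τ a hτ hy
    rw [hl] at hqq hq0 hq1
    have h2 : (l * l - l) • (1 : Ultraproduct τ.bounded ω) = 0 := by
      rw [← Algebra.algebraMap_eq_smul_one, map_sub, map_mul, hqq, sub_self]
    have h3 := (smul_eq_zero.1 h2).resolve_right (one_ne_zero_ultraproduct τ ω)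
    have h4 : l * (l - 1) = 0 := by rw [← h3]; ring
    obtain rfl | h5 := mul_eq_zero.1 h4
    · exact hq0 (map_zero _)
    · exact hq1 (by rw [sub_eq_zero.1 h5, map_one])
  -- For an ultrafilter, failing to hold eventually is the same as eventually failing, so a single
  -- `δ` bounds the 2-norms from below on a set of `ω`.
  rw [Metric.tendsto_nhds] at hnot
  push Not at hnot
  obtain ⟨δ, hδ, hδ'⟩ := hnot
  refine ⟨fun n => (a : ℕ → Q.toStarSubalgebra) n -
    τ.toLin ((a : ℕ → Q.toStarSubalgebra) n) • (1 : Q.toStarSubalgebra),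
    C + C * D * ‖(1 : Q.toStarSubalgebra)‖, δ, fun n => ?_,
    fun n => trace_sub_trace_smul_one τ _, hδ, ?_, fun h => ?_⟩
  · refine (norm_sub_le _ _).trans (add_le_add (hC n) ?_)
    rw [norm_smul]
    exact mul_le_mul_of_nonneg_right (hτ n) (norm_nonneg _)
  · refine hδ'.mono fun n hn => ?_
    rw [Real.dist_0_eq_abs] at hn
    exact hn.trans_eq (abs_of_nonneg (Real.sqrt_nonneg _))
  · simp only [toHom_sub_smul_one_sub]
    exact tendsto_of_mem_ultraFixed hq h

/-- A diagonal choice replaces the limit along `ω` by an ordinary one, and normalisation costs at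
most the factor `δ⁻¹`. -/
theorem exists_central_sequence [Countable H] {ω : Ultrafilter ℕ}
    (hdiff : IsDiffuse (σ.ultraFixed ω)) :
    ∃ (x : ℕ → Q.toStarSubalgebra) (C : ℝ), (∀ n, ‖x n‖ ≤ C) ∧ (∀ n, τ.toLin (x n) = 0) ∧
      (∀ n, twoNorm τ.toLin (x n) = 1) ∧
      ∀ h, Tendsto (fun n => twoNorm τ.toLin (σ.toHom h (x n) - x n)) atTop (𝓝 0) := by
  obtain ⟨y, C, δ, hC, hτ, hδ, hyδ, hy⟩ := exists_asymptotically_fixed hdiff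
  obtain ⟨e, he⟩ := exists_surjective_nat H
  -- Only finitely many conditions are imposed at stage `m`, each holding along `ω`, so some index
  -- satisfies them all. The element `e j` is controlled from stage `j` on.
  have hex : ∀ m : ℕ, ∃ n, δ ≤ twoNorm τ.toLin (y n) ∧ ∀ j ∈ Finset.range (m + 1),
      twoNorm τ.toLin (σ.toHom (e j) (y n) - y n) < 1 / ((m : ℝ) + 1) := fun m =>
    (hyδ.and ((Filter.eventually_all_finset _).2 fun j _ =>
      (hy (e j)).eventually (gt_mem_nhds (by positivity)))).exists
  choose n hn1 hn2 using hex
  let r : ℕ → ℝ := fun m => (twoNorm τ.toLin (y (n m)))⁻¹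
  have hpos : ∀ m, 0 < twoNorm τ.toLin (y (n m)) := fun m => hδ.trans_le (hn1 m)
  have hr0 : ∀ m, 0 ≤ r m := fun m => (inv_pos.2 (hpos m)).le
  have hr : ∀ m, r m ≤ δ⁻¹ := fun m => inv_anti₀ hδ (hn1 m)
  have hnorm : ∀ m, ‖(r m : ℂ)‖ = r m := fun m => by
    rw [Complex.norm_real, Real.norm_of_nonneg (hr0 m)]
  refine ⟨fun m => (r m : ℂ) • y (n m), δ⁻¹ * C, fun m => ?_, fun m => ?_, fun m => ?_, fun h => ?_⟩
  · rw [norm_smul, hnorm]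
    exact mul_le_mul (hr m) (hC _) (norm_nonneg _) (inv_pos.2 hδ).le
  · rw [map_smul, hτ, smul_zero]
  · rw [twoNorm_smul, hnorm]
    exact inv_mul_cancel₀ (hpos m).ne'
  · obtain ⟨j, rfl⟩ := he h
    have hlim : Tendsto (fun m : ℕ => δ⁻¹ * (1 / ((m : ℝ) + 1))) atTop (𝓝 0) := by
      simpa using tendsto_one_div_add_atTop_nhds_zero_nat.const_mul δ⁻¹
    refine squeeze_zero' (Eventually.of_forall fun m => Real.sqrt_nonneg _) ?_ hlim
    filter_upwards [eventually_ge_atTop j] with m hm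
    rw [map_smul, ← smul_sub, twoNorm_smul, hnorm]
    exact mul_le_mul (hr m) (hn2 m j (Finset.mem_range.2 (by omega))).le (Real.sqrt_nonneg _)
      (inv_pos.2 hδ).le

variable (σ)

/-- The element `π(a)` of the crossed product. -/
def repCrossed (a : Q.toStarSubalgebra) : σ.crossedProduct.toStarSubalgebra :=
  ⟨σ.rep a, σ.rep_mem a⟩

theorem norm_repCrossed_le (a : Q.toStarSubalgebra) : ‖σ.repCrossed a‖ ≤ ‖a‖ := σ.norm_rep_le a

theorem twoNorm_rep (a : Q.toStarSubalgebra) :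
    twoNorm σ.crossedTrace.toLin (σ.repCrossed a) = twoNorm τ.toLin a := by
  have h : σ.coeff (star (σ.repCrossed a) * (σ.repCrossed a)) 1 = star a * a := by
    refine Subtype.ext ?_
    change entry (star (σ.rep a) * σ.rep a) 1 1 = _
    rw [star_rep, ← rep_mul, entry_rep_self, inv_one, toHom_one_apply]
  rw [twoNorm, crossedTrace_apply, h]
  rfl

/-- The commutator of `λ(k)` with `π(x n)` is exactly `π(σ_k(x n) - x n) λ(k)`. -/
theorem leftTranslation_mem_asymptoticCommutant {x : ℕ → Q.toStarSubalgebra}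
    (hx : ∀ h, Tendsto (fun n => twoNorm τ.toLin (σ.toHom h (x n) - x n)) atTop (𝓝 0)) (k : H) :
    (⟨leftTranslation K k, σ.leftTranslation_mem k⟩ : σ.crossedProduct.toStarSubalgebra) ∈
      asymptoticCommutant σ.crossedTrace fun n => σ.repCrossed (x n) := by
  set u : σ.crossedProduct.toStarSubalgebra := ⟨leftTranslation K k, σ.leftTranslation_mem k⟩
  have h1 := hx k
  simp only [← σ.twoNorm_rep] at h1
  rw [tendsto_twoNorm_iff σ.crossedTrace.bounded] at h1
  rw [mem_asymptoticCommutant, tendsto_twoNorm_iff σ.crossedTrace.bounded]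
  have h3 := h1.const_mul (‖u‖ ^ 2)
  rw [mul_zero] at h3
  refine squeeze_zero (fun n => σ.crossedTrace.bounded.nonneg _) (fun n => ?_) h3
  have h2 : u * σ.repCrossed (x n) - σ.repCrossed (x n) * u =
      σ.repCrossed (σ.toHom k (x n) - x n) * u := by
    refine Subtype.ext ?_
    change leftTranslation K k * σ.rep (x n) - σ.rep (x n) * leftTranslation K k =
      σ.rep (σ.toHom k (x n) - x n) * leftTranslation K k
    rw [leftTranslation_mul_rep, rep_sub, sub_mul]
  rw [h2]
  exact sq_mul_le' σ.crossedTrace.bounded _ _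

/-- Sequences that are asymptotically fixed by `σ` commute asymptotically with `L(H)`, since `L(H)`
is the closure of the group algebra in the 2-norm. -/
theorem mem_asymptoticCommutant_of_mem_groupVN {x : ℕ → Q.toStarSubalgebra} {C : ℝ}
    (hC : ∀ n, ‖x n‖ ≤ C)
    (hx : ∀ h, Tendsto (fun n => twoNorm τ.toLin (σ.toHom h (x n) - x n)) atTop (𝓝 0))
    {y : σ.crossedProduct.toStarSubalgebra}
    (hy : (y : L2 H K →L[ℂ] L2 H K) ∈ groupVN H K) :
    y ∈ asymptoticCommutant σ.crossedTrace fun n => σ.repCrossed (x n) := by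
  have hz : ∀ n, ‖σ.repCrossed (x n)‖ ≤ C := fun n => (σ.norm_repCrossed_le (x n)).trans (hC n)
  refine mem_asymptoticCommutant_of_approx σ.crossedTrace hz fun ε hε => ?_
  obtain ⟨ζ, hs, -, hsq⟩ := exists_vectors σ.crossedTrace
  -- The vectors `ζ` implement the trace of the crossed product, so approximation on them is
  -- approximation in the 2-norm.
  obtain ⟨a, ha, hlt⟩ := exists_approx star_mem_range_leftTranslation (groupAlgebra H K)
    (Submodule.subset_span ⟨1, leftTranslation_one⟩) mul_mem_groupAlgebra
    ((mem_vnGenerated_iff star_mem_range_leftTranslation).1 hy) hs hε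
  have hle : groupAlgebra H K ≤ (asymptoticCommutant σ.crossedTrace
      fun n => σ.repCrossed (x n)).map
        σ.crossedProduct.toStarSubalgebra.subtype.toAlgHom.toLinearMap := by
    refine Submodule.span_le.2 ?_
    rintro _ ⟨k, rfl⟩
    exact ⟨_, σ.leftTranslation_mem_asymptoticCommutant hx k, rfl⟩
  obtain ⟨b, hb, rfl⟩ := hle ha
  refine ⟨b, hb, ?_⟩
  rw [← (hsq (y - b)).tsum_eq]
  exact hlt.le

theorem hasPropertyGammaRelativeTo [Countable H] {ω : Ultrafilter ℕ}
    (hdiff : IsDiffuse (σ.ultraFixed ω)) :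
    HasPropertyGammaRelativeTo (groupVN H K) σ.crossedProduct := by
  obtain ⟨x, C, hC, hτ, h1, hx⟩ := exists_central_sequence hdiff
  obtain ⟨E, hE, hentry⟩ := σ.exists_condExp
  refine ⟨fun y => σ.groupVN_le, σ.crossedTrace, E, hE,
    fun n => σ.repCrossed (x n), ⟨C, fun n => (σ.norm_repCrossed_le (x n)).trans (hC n)⟩,
    fun n => (σ.twoNorm_rep (x n)).trans (h1 n), fun n => Subtype.ext (ext_entry fun g h => ?_),
    fun y hy => σ.mem_asymptoticCommutant_of_mem_groupVN hC hx hy⟩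
  rw [hentry]
  -- The only coefficient of `π(x n)` that can be non-zero is the one at `1`, namely `x n`, and its
  -- trace vanishes.
  have hzero : τ.toLin (σ.coeff (σ.repCrossed (x n)) (g * h⁻¹)) = 0 := by
    obtain hg | hg := eq_or_ne (g * h⁻¹) 1
    · have h2 : σ.coeff (σ.repCrossed (x n)) 1 = x n := by
        refine Subtype.ext ?_
        change entry (σ.rep (x n)) 1 1 = _
        rw [entry_rep_self, inv_one, toHom_one_apply]
      rw [hg, h2, hτ]
    · have h2 : σ.coeff (σ.repCrossed (x n)) (g * h⁻¹) = 0 :=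
        Subtype.ext (σ.entry_rep_ne (x n) hg)
      rw [h2, map_zero]
  rw [hzero, zero_smul]
  rfl

end TraceAction

end RelGamma

end

theorem mainTheorem6
    {K : Type*} [NormedAddCommGroup K] [InnerProductSpace ℂ K] [CompleteSpace K]
    {H : Type*} [Group H] [Countable H] (hicc : RelGamma.IsICC H)
    (Q : VonNeumannAlgebra K) (hQ : RelGamma.IsIIOneFactor Q)
    (τ : RelGamma.FaithfulNormalTrace Q) (σ : RelGamma.TraceAction H τ)
    (ω : Ultrafilter ℕ) (hω : (ω : Filter ℕ) ≤ Filter.cofinite)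
    (herg : σ.IsErgodic)
    (hdiff : RelGamma.IsDiffuse (σ.ultraFixed ω)) :
    RelGamma.IsIrreducibleSubfactor (RelGamma.groupVN H K) σ.crossedProduct ∧
      RelGamma.HasPropertyGammaRelativeTo (RelGamma.groupVN H K) σ.crossedProduct :=
  ⟨herg.isIrreducibleSubfactor hicc hQ, σ.hasPropertyGammaRelativeTo hdiff⟩
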